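/- Let $N\cong\mathbb Z^n$ be a lattice with dual lattice $M$, and let $\Delta$ be a (finite, nonempty) fan of strongly convex rational polyhedral cones in $N_{\mathbb R}$ whose support $|\Delta|$ is convex and $n$-dimensional, with associated toric variety $X=X(\Delta)$. Let $\Delta(1)$ be its set of rays, $v_\rho$ the primitive generator of $\rho\in\Delta(1)$, and $D_\rho$ the corresponding prime divisor. Write $A_{n-1}(X)_{\mathbb R}=\mathbb R^{\Delta(1)}/M_{\mathbb R}$ for the group of $T$-$\mathbb R$-Weil divisors $D=\sum d_\rho D_\rho$ modulo the divisors $\sum\langle u,v_\rho\rangle D_\rho$ ($u\in M_{\mathbb R}$), with its lattice of classes of integral divisors; the effective cone is the set of classes of divisors with all $d_\rho\ge 0$. For an effective divisor $D=\sum d_\rho D_\rho$ let $P_D=\{u\in M_{\mathbb R}:\langle u,v_\rho\rangle\ge -d_\rho\ \text{for all }\rho\in\Delta(1)\}$. Let $\Sigma_D$ be the normal fan of $P_D$, whose cones are $\sigma_Q=\{v\in|\Delta|:\langle u,v\rangle\ge\langle u',v\rangle\ \text{for all }u\in P_D,\,u'\in Q\}$ for $Q$ a nonempty face of $P_D$.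 Let $I_D\subseteq\Delta(1)$ be the set of rays $\rho$ with $\min_{u\in P_D}\langle u,v_\rho\rangle\ne -d_\rho$. A possibly degenerate fan is a finite nonempty collection of (not necessarily strongly convex) rational polyhedral cones in $N_{\mathbb R}$, closed under taking faces, such that any two of its cones intersect in a face of each; $L_\Sigma$ denotes the intersection of all cones of $\Sigma$, a linear subspace, and $X_\Sigma$ the toric variety of the fan induced by $\Sigma$ in $N_{\mathbb R}/L_\Sigma$. Its $T$-$\mathbb Q$-Cartier divisors are the functions on $|\Sigma|$ that are given on each cone of $\Sigma$ by an element of $M_{\mathbb Q}$ and that vanish on $L_\Sigma$; $\mathrm{Pic}(X_\Sigma)_{\mathbb Q}$ is the quotient of this space by the functions given on all of $|\Sigma|$ by a single element of $M_{\mathbb Q}$. When $|\Sigma|$ is convex and $n$-dimensional, $X_\Sigma$ is quasiprojective if and only if one of these functions $\psi$ is strictly convex, i.e. for every maximal cone $\sigma\in\Sigma$ there is $u_\sigma\in M_{\mathbb Q}$ with $\psi=u_\sigma$ on $\sigma$ and $\psi<u_\sigma$ on $|\Sigma|\smallsetminus\sigma$. Given two possibly degenerate fans, $\Sigma$ refines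 $\Sigma'$ if $|\Sigma|=|\Sigma'|$ and every cone of $\Sigma$ is contained in a cone of $\Sigma'$. Call $(\Sigma,I)$ admissible if $\Sigma$ is a possibly degenerate fan with $|\Sigma|=|\Delta|$ such that $X_\Sigma$ is quasiprojective, and $I\subseteq\Delta(1)$ is a set of rays such that every cone of $\Sigma$ is positively spanned by rays in $\Delta(1)\smallsetminus I$. The GKZ cone of an admissible pair is $$\gamma_{\Sigma,I}=\{[D]\in A_{n-1}(X)_{\mathbb R}: D\ \text{effective},\ \Sigma\ \text{refines}\ \Sigma_D\ \text{and}\ I_D\subseteq I\}.$$ **GKZ Decomposition Theorem.** For every admissible pair $(\Sigma,I)$, the set $\gamma_{\Sigma,I}$ is a convex rational polyhedral cone of dimension $\dim_{\mathbb Q}\mathrm{Pic}(X_\Sigma)_{\mathbb Q}+\#I$. The set of all GKZ cones is a fan (of strongly convex rational polyhedral cones) in $A_{n-1}(X)_{\mathbb R}$ whose support is the effective cone. The faces of $\gamma_{\Sigma,I}$ are exactly the cones $\gamma_{\Sigma',I'}$ for admissible pairs $(\Sigma',I')$ such that $\Sigma$ refines $\Sigma'$ and $I'\subseteq I$; moreover,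 for an admissible pair $(\Sigma',I')$, the cone $\gamma_{\Sigma',I'}$ is a face of $\gamma_{\Sigma,I}$ only if $\Sigma$ refines $\Sigma'$ and $I'\subseteq I$. -/

import Mathlib

open scoped Matrix

namespace GKZ

noncomputable section

/-! ### Cones and fans -/

section Fans

variable {V : Type*} [AddCommGroup V] [Module ℝ V]

/-- A convex rational polyhedral cone: one that is positively spanned by finitely many
elements of the given set `Λ` of lattice points. -/
def IsRationalPolyhedral (Λ : Set V) (σ : PointedCone ℝ V) : Prop :=
  ∃ S : Finset V, (S : Set V) ⊆ Λ ∧ σ = PointedCone.hull ℝ (S : Set V)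

/-- A possibly degenerate fan: a finite nonempty collection of convex (not necessarily strongly
convex) rational polyhedral cones, closed under passing to faces, in which any two cones
intersect in a face of each. -/
structure IsPossiblyDegenerateFan (Λ : Set V) (F : Set (PointedCone ℝ V)) : Prop where
  finite : F.Finite
  nonempty : F.Nonempty
  rational : ∀ σ ∈ F, IsRationalPolyhedral Λ σ
  face_mem : ∀ σ ∈ F, ∀ τ : PointedCone ℝ V, τ.IsFaceOf σ → τ ∈ F
  inter_left : ∀ σ ∈ F, ∀ τ ∈ F, (σ ⊓ τ).IsFaceOf σ
  inter_right : ∀ σ ∈ F, ∀ τ ∈ F, (σ ⊓ τ).IsFaceOf τ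

/-- A fan in the usual sense: moreover every cone is strongly convex. -/
structure IsFan (Λ : Set V) (F : Set (PointedCone ℝ V)) : Prop
    extends IsPossiblyDegenerateFan Λ F where
  stronglyConvex : ∀ σ ∈ F, ∀ x ∈ σ, -x ∈ σ → x = 0

/-- The support `|F|`, the union of the cones. -/
def support (F : Set (PointedCone ℝ V)) : Set V := ⋃ σ ∈ F, (σ : Set V)

/-- `F` refines `G`: they have the same support and each cone of `F` lies in a cone of `G`. -/
def Refines (F G : Set (PointedCone ℝ V)) : Prop :=
  support F = support G ∧ ∀ σ ∈ F, ∃ τ ∈ G, σ ≤ τ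

/-- The intersection `L_F` of all cones of `F`. -/
def linealitySpace (F : Set (PointedCone ℝ V)) : Set V := ⋂ σ ∈ F, (σ : Set V)

/-- The dimension of a cone (or of any set containing `0`): the dimension of its linear span. -/
def coneDim (s : Set V) : ℕ := Module.finrank ℝ (Submodule.span ℝ s)

end Fans

/-! ### The lattice `N = ℤⁿ` with dual lattice `M = ℤⁿ`; the pairing is the dot product -/

variable {n : ℕ}

/-- An element of `N` as an element of `N_ℝ`. -/
def toReal (v : Fin n → ℤ) : Fin n → ℝ := fun i => (v i : ℝ)

/-- An element of `M_ℚ` as an element of `M_ℝ`. -/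
def ratToReal (u : Fin n → ℚ) : Fin n → ℝ := fun i => (u i : ℝ)

/-- The lattice points of `N_ℝ`. -/
def latticeN (n : ℕ) : Set (Fin n → ℝ) := Set.range toReal

/-- A lattice vector is primitive if it is not a multiple of another one by a non-unit
(in particular it is not zero). -/
def IsPrimitive (v : Fin n → ℤ) : Prop := ∀ (k : ℤ) (w : Fin n → ℤ), v = k • w → IsUnit k

/-- The set of rays `Δ(1)`; a ray `ρ` is represented by its primitive lattice generator `v_ρ`. -/
def Ray (Δ : Set (PointedCone ℝ (Fin n → ℝ))) : Type :=
  {v : Fin n → ℤ // IsPrimitive v ∧ PointedCone.hull ℝ {toReal v} ∈ Δ}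

/-- The primitive generator `v_ρ` of a ray, in `N_ℝ`. -/
def Ray.gen {Δ : Set (PointedCone ℝ (Fin n → ℝ))} (ρ : Ray Δ) : Fin n → ℝ := toReal ρ.1

/-! ### Line bundles on `X_Σ` -/

/-- The `T`-`ℚ`-Cartier divisors on `X_Σ`, for a possibly degenerate fan `Σ`: the functions on
`|Σ|` that are given on each cone of `Σ` by an element of `M_ℚ`, and that vanish on `L_Σ`. -/
def cartierQ (S : Set (PointedCone ℝ (Fin n → ℝ))) : Submodule ℚ (support S → ℝ) where
  carrier := {ψ | (∀ σ ∈ S, ∃ u : Fin n → ℚ, ∀ v : support S, (v : Fin n → ℝ) ∈ σ →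
      ψ v = ratToReal u ⬝ᵥ (v : Fin n → ℝ)) ∧
    ∀ v : support S, (v : Fin n → ℝ) ∈ linealitySpace S → ψ v = 0}
  zero_mem' := ⟨fun σ _ => ⟨0, fun v _ => by simp [ratToReal, dotProduct]⟩, fun _ _ => rfl⟩
  add_mem' := by
    rintro ψ φ ⟨h₁, h₁'⟩ ⟨h₂, h₂'⟩
    refine ⟨fun σ hσ => ?_, fun v hv => by simp [h₁' v hv, h₂' v hv]⟩
    obtain ⟨u, hu⟩ := h₁ σ hσ
    obtain ⟨w, hw⟩ := h₂ σ hσ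
    refine ⟨u + w, fun v hv => ?_⟩
    simp [hu v hv, hw v hv, ratToReal, dotProduct, add_mul, Finset.sum_add_distrib]
  smul_mem' := by
    rintro c ψ ⟨h₁, h₁'⟩
    refine ⟨fun σ hσ => ?_, fun v hv => by simp [h₁' v hv]⟩
    obtain ⟨u, hu⟩ := h₁ σ hσ
    refine ⟨c • u, fun v hv => ?_⟩
    simp [hu v hv, ratToReal, dotProduct, Finset.mul_sum, mul_assoc, Rat.smul_def]

/-- The principal `T`-`ℚ`-divisors on `X_Σ`: those given on all of `|Σ|` by one element
of `M_ℚ` (necessarily vanishing on `L_Σ`). -/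
def principalQ (S : Set (PointedCone ℝ (Fin n → ℝ))) : Submodule ℚ (cartierQ S) where
  carrier := {ψ | ∃ u : Fin n → ℚ, ∀ v : support S, ψ.1 v = ratToReal u ⬝ᵥ (v : Fin n → ℝ)}
  zero_mem' := ⟨0, fun v => by simp [ratToReal, dotProduct]⟩
  add_mem' := by
    rintro ψ φ ⟨u, hu⟩ ⟨w, hw⟩
    refine ⟨u + w, fun v => ?_⟩
    simp [hu v, hw v, ratToReal, dotProduct, add_mul, Finset.sum_add_distrib]
  smul_mem' := by
    rintro c ψ ⟨u, hu⟩
    refine ⟨c • u, fun v => ?_⟩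
    simp [hu v, ratToReal, dotProduct, Finset.mul_sum, mul_assoc, Rat.smul_def]

/-- `Pic(X_Σ)_ℚ`: the `T`-`ℚ`-Cartier divisors modulo linear equivalence. -/
abbrev PicQ (S : Set (PointedCone ℝ (Fin n → ℝ))) : Type := cartierQ S ⧸ principalQ S

/-- `X_Σ` is quasiprojective, for a possibly degenerate fan `Σ` with convex full-dimensional
support: some `T`-`ℚ`-Cartier divisor on `X_Σ` is ample, that is, its piecewise linear function
`ψ` is strictly convex: for each maximal cone `σ`, the graph of `ψ` coincides over `σ` with the
graph of a linear function `u`, and lies strictly below it outside `σ`. -/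
def IsQuasiprojective (S : Set (PointedCone ℝ (Fin n → ℝ))) : Prop :=
  ∃ ψ ∈ cartierQ S, ∀ σ, Maximal (· ∈ S) σ → ∃ u : Fin n → ℚ, ∀ v : support S,
    ((v : Fin n → ℝ) ∈ σ → ψ v = ratToReal u ⬝ᵥ (v : Fin n → ℝ)) ∧
    ((v : Fin n → ℝ) ∉ σ → ψ v < ratToReal u ⬝ᵥ (v : Fin n → ℝ))

/-! ### Weil divisors on `X = X(Δ)` -/

variable (Δ : Set (PointedCone ℝ (Fin n → ℝ)))

/-- The `T`-`ℝ`-Weil divisors `∑ d_ρ D_ρ` on `X(Δ)`. -/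
abbrev WeilDivisor : Type := Ray Δ → ℝ

/-- The divisor `∑ ⟨u, v_ρ⟩ D_ρ` of `u ∈ M_ℝ`. -/
def divisorOf : (Fin n → ℝ) →ₗ[ℝ] WeilDivisor Δ where
  toFun u ρ := u ⬝ᵥ ρ.gen
  map_add' u w := by ext ρ; simp [add_dotProduct]
  map_smul' c u := by ext ρ; simp [smul_dotProduct]

/-- `A_{n-1}(X)_ℝ`: the `T`-`ℝ`-Weil divisors modulo linear equivalence. -/
abbrev ClassGroup : Type := WeilDivisor Δ ⧸ LinearMap.range (divisorOf Δ)

/-- The class `[D]`. -/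
def cls (D : WeilDivisor Δ) : ClassGroup Δ := Submodule.Quotient.mk D

/-- The image of `A_{n-1}(X)` in `A_{n-1}(X)_ℝ`: the classes of integral divisors. -/
def integralClasses : Set (ClassGroup Δ) :=
  Set.range fun d : Ray Δ → ℤ => cls Δ fun ρ => (d ρ : ℝ)

/-- The effective cone. -/
def effectiveCone : Set (ClassGroup Δ) := {c | ∃ D : WeilDivisor Δ, 0 ≤ D ∧ cls Δ D = c}

variable {Δ}

/-- The polyhedron `P_D = {u ∈ M_ℝ : ⟨u, v_ρ⟩ ≥ -d_ρ for all ρ}`. -/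
def polyhedron (D : WeilDivisor Δ) : Set (Fin n → ℝ) := {u | ∀ ρ : Ray Δ, -D ρ ≤ u ⬝ᵥ ρ.gen}

/-- The set `σ_Q = {v ∈ |Δ| : ⟨u, v⟩ ≥ ⟨u', v⟩ for all u ∈ P_D, u' ∈ Q}`. -/
def normalCone (D : WeilDivisor Δ) (Q : Set (Fin n → ℝ)) : Set (Fin n → ℝ) :=
  {v | v ∈ support Δ ∧ ∀ u ∈ polyhedron D, ∀ u' ∈ Q, u' ⬝ᵥ v ≤ u ⬝ᵥ v}

/-- The normal fan `Σ_D`, whose cones are the `σ_Q` for the nonempty faces `Q` of `P_D`. -/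
def normalFan (D : WeilDivisor Δ) : Set (PointedCone ℝ (Fin n → ℝ)) :=
  {σ | ∃ Q : Set (Fin n → ℝ), Q.Nonempty ∧ IsExposed ℝ (polyhedron D) Q ∧
    (σ : Set (Fin n → ℝ)) = normalCone D Q}

/-- The set `I_D` of rays `ρ` for which `Ξ_D(v_ρ) = min {⟨u, v_ρ⟩ : u ∈ P_D}` is not
equal to `-d_ρ`. -/
def excessRays (D : WeilDivisor Δ) : Set (Ray Δ) :=
  {ρ | ¬ IsLeast ((fun u => u ⬝ᵥ ρ.gen) '' polyhedron D) (-D ρ)}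

/-! ### GKZ cones -/

/-- The pairs `(Σ, I)` that index the GKZ cones: `Σ` is a possibly degenerate fan with support
`|Δ|`, `X_Σ` is quasiprojective, and every cone of `Σ` is positively spanned by rays
in `Δ(1) ∖ I`. -/
structure IsGKZPair (Δ S : Set (PointedCone ℝ (Fin n → ℝ))) (I : Set (Ray Δ)) : Prop where
  fan : IsPossiblyDegenerateFan (latticeN n) S
  support_eq : support S = support Δ
  quasiprojective : IsQuasiprojective S
  spanned : ∀ σ ∈ S, ∃ J : Set (Ray Δ), J ⊆ Iᶜ ∧ σ = PointedCone.hull ℝ (Ray.gen '' J)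

/-- The GKZ cone `γ_{Σ,I}`, as a set of classes of effective divisors. -/
def gkzCone (Δ S : Set (PointedCone ℝ (Fin n → ℝ))) (I : Set (Ray Δ)) : Set (ClassGroup Δ) :=
  {c | ∃ D : WeilDivisor Δ, 0 ≤ D ∧ cls Δ D = c ∧ Refines S (normalFan D) ∧ excessRays D ⊆ I}

/-- The collection of all GKZ cones. -/
def gkzFan (Δ : Set (PointedCone ℝ (Fin n → ℝ))) : Set (PointedCone ℝ (ClassGroup Δ)) :=
  {C | ∃ (S : Set (PointedCone ℝ (Fin n → ℝ))) (I : Set (Ray Δ)),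
    IsGKZPair Δ S I ∧ (C : Set (ClassGroup Δ)) = gkzCone Δ S I}

end

end GKZ

/-! Everything is read off from a finite vector configuration `g` (finally the generators v_ρ) and
its polyhedra `poly g D`. A set K of indices is a face set of D if the inequalities in K are
equalities at a common point of the polyhedron. For nonempty polyhedra, Σ_D refines Σ_E with I_E ⊆
I_D exactly when every face set of D is a face set of E (`refines_normalFan_iff`). These E form a
convex cone, `chamber g D`. Each D with nonempty polyhedron gives an admissible pair
(`isGKZPair_normalFan`), and each admissible pair is (Σ_D, I_D) for an effective D built from a
strictly convex function (`IsGKZPair.exists_divisor`). So the GKZ cones are the images of chambers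
in the class group.

The fan structure rests on `IsFaceSet.of_add`: if x and y lie in one chamber, a face set of x + y is
a face set of x. The minima defined by x and y are then linear on common cones, so they add up, and
two nonnegative slacks with sum 0 both vanish. It follows that the chamber of a member E of `chamber
g D` is a face, that two chambers meet in a face, and that opposite elements of a chamber are
linear, hence zero in the class group. Conversely, a face of a chamber is the chamber of an element
E of it with the fewest face sets: a small multiple of any element of `chamber g E` can be
subtracted from E without leaving `chamber g E`.

For rationality, a point u_K is adjoined as an unknown for every face set K. The chamber becomes a
projection of a cone cut out by integral half spaces, and the double description method gives
integral generators (`exists_hull_eq_chamber`).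

For the dimension, a chamber spans the vectors that are linear on each face set. Over ℚ these are
the image of Cartier divisors, multiplicities on I_D and linear functions, with kernel the principal
divisors. Rank–nullity gives dim Pic + #I_D + n, and passing to classes removes n. -/

namespace GKZ

/-! ### Finitely generated cones -/

section Cones

variable {V : Type*} [AddCommGroup V] [Module ℝ V]

theorem smul_mem_cone (C : PointedCone ℝ V) {c : ℝ} (hc : 0 ≤ c) {x : V} (hx : x ∈ C) :
    c • x ∈ C :=
  PointedCone.smul_mem C hc hx

/-- **Farkas' lemma**, for finitely many linear functionals. -/
theorem farkas {ι : Type*} (s : Finset ι) (a : ι → V →ₗ[ℝ] ℝ) (b : V →ₗ[ℝ] ℝ)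
    (h : ∀ x, (∀ i ∈ s, 0 ≤ a i x) → 0 ≤ b x) :
    ∃ c : ι → ℝ, (∀ i, 0 ≤ c i) ∧ b = ∑ i ∈ s, c i • a i := by
  classical
  induction s using Finset.induction_on generalizing a b with
  | empty =>
    refine ⟨0, fun _ => le_rfl, ?_⟩
    ext x
    have h1 := h x (by simp)
    have h2 := h (-x) (by simp)
    rw [map_neg] at h2
    simp only [Finset.sum_empty, LinearMap.zero_apply]
    linarith
  | insert m s hm ih =>
    by_cases hb : ∀ x, (∀ i ∈ s, 0 ≤ a i x) → 0 ≤ b x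
    · obtain ⟨c, hc, hbc⟩ := ih a b hb
      refine ⟨Function.update c m 0, fun i => ?_, ?_⟩
      · by_cases hi : i = m
        · subst hi; simp
        · simpa [hi] using hc i
      · rw [Finset.sum_insert hm, hbc]
        simp only [Function.update_self, zero_smul, zero_add]
        refine Finset.sum_congr rfl fun i hi => ?_
        rw [Function.update_of_ne (by rintro rfl; exact hm hi)]
    · push Not at hb
      obtain ⟨y, hy, hby⟩ := hb
      have hmy : a m y < 0 := by
        by_contra hcon
        refine absurd (h y fun i hi => ?_) (not_le.2 hby)
        rcases Finset.mem_insert.1 hi with rfl | hi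
        · exact not_lt.1 hcon
        · exact hy i hi
      -- With this scaling x ↦ x + t·a_m(x)·y is the projection along y onto the kernel of a_m.
      -- After composition with it the condition at m is vacuous, so the induction hypothesis
      -- applies to the composed functionals.
      set t : ℝ := -(a m y)⁻¹ with ht
      have htpos : 0 < t := by rw [ht]; exact neg_pos.2 (inv_lt_zero.2 hmy)
      have hty : t * a m y = -1 := by rw [ht, neg_mul, inv_mul_cancel₀ hmy.ne]
      obtain ⟨c, hc, hbc⟩ := ih (fun i => a i + (t * a i y) • a m) (b + (t * b y) • a m) (by
        intro x hx
        have := h (x + (t * a m x) • y) (by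
          intro i hi
          rcases Finset.mem_insert.1 hi with rfl | hi
          · have : a i (x + (t * a i x) • y) = a i x * (1 + t * a i y) := by
              simp only [map_add, map_smul, smul_eq_mul]; ring
            rw [this, hty]; simp
          · have := hx i hi
            simp only [LinearMap.add_apply, LinearMap.smul_apply, map_add, map_smul,
              smul_eq_mul] at this ⊢
            linarith)
        simp only [LinearMap.add_apply, LinearMap.smul_apply, map_add, map_smul,
          smul_eq_mul] at this ⊢
        linarith)
      -- The coefficient of a_m once the resulting identity is solved for b; it is nonnegative since
      -- a_i(y) ≥ 0 and b(y) < 0.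
      set d : ℝ := ∑ i ∈ s, c i * (t * a i y) - t * b y with hd
      have hdn : 0 ≤ d := by
        have h1 : 0 ≤ ∑ i ∈ s, c i * (t * a i y) :=
          Finset.sum_nonneg fun i hi => mul_nonneg (hc i) (mul_nonneg htpos.le (hy i hi))
        have h2 : t * b y ≤ 0 := mul_nonpos_of_nonneg_of_nonpos htpos.le hby.le
        linarith
      refine ⟨Function.update c m d, fun i => ?_, ?_⟩
      · by_cases hi : i = m
        · subst hi; simpa using hdn
        · simpa [hi] using hc i
      · rw [Finset.sum_insert hm, Function.update_self]
        have h1 : ∑ i ∈ s, Function.update c m d i • a i = ∑ i ∈ s, c i • a i :=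
          Finset.sum_congr rfl fun i hi => by
            rw [Function.update_of_ne (by rintro rfl; exact hm hi)]
        rw [h1]
        ext x
        have h2 := LinearMap.congr_fun hbc x
        simp only [LinearMap.add_apply, LinearMap.smul_apply, LinearMap.coe_sum,
          Finset.sum_apply, smul_eq_mul, mul_add, Finset.sum_add_distrib] at h2 ⊢
        rw [hd, sub_mul, Finset.sum_mul]
        simp only [mul_assoc] at h2 ⊢
        linarith

theorem mem_hull_image {ι : Type*} [Fintype ι] {g : ι → V} {K : Set ι} {x : V} :
    x ∈ PointedCone.hull ℝ (g '' K) ↔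
      ∃ c : ι → ℝ, (∀ i, 0 ≤ c i) ∧ (∀ i ∉ K, c i = 0) ∧ x = ∑ i, c i • g i := by
  classical
  constructor
  · intro hx
    induction hx using Submodule.span_induction with
    | mem x hx =>
      obtain ⟨i, hi, rfl⟩ := hx
      refine ⟨Pi.single i 1, fun j => ?_, fun j hj => ?_, ?_⟩
      · by_cases h : j = i
        · subst h; simp
        · simp [h]
      · have : j ≠ i := by rintro rfl; exact hj hi
        simp [this]
      · simp [Pi.single_apply, ite_smul]
    | zero => exact ⟨0, by simp, by simp, by simp⟩
    | add x y _ _ hx hy =>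
      obtain ⟨c, hc, hcK, rfl⟩ := hx
      obtain ⟨d, hd, hdK, rfl⟩ := hy
      exact ⟨c + d, fun i => add_nonneg (hc i) (hd i), fun i hi => by simp [hcK i hi, hdK i hi],
        by simp [add_smul, Finset.sum_add_distrib]⟩
    | smul a x _ hx =>
      obtain ⟨c, hc, hcK, rfl⟩ := hx
      refine ⟨fun i => (a : ℝ) * c i, fun i => mul_nonneg a.2 (hc i),
        fun i hi => by simp [hcK i hi], ?_⟩
      rw [Finset.smul_sum]
      exact Finset.sum_congr rfl fun i _ => by rw [mul_smul]; rfl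
  · rintro ⟨c, hc, hcK, rfl⟩
    refine Submodule.sum_mem _ fun i _ => ?_
    by_cases hi : i ∈ K
    · exact smul_mem_cone _ (hc i) (Submodule.subset_span ⟨i, hi, rfl⟩)
    · rw [hcK i hi, zero_smul]; exact Submodule.zero_mem _

/-- One step of the double description method: a half space cuts a finitely generated cone in a
finitely generated one, and the generators stay in `Λ`. -/
theorem exists_hull_eq_halfSpace (Λ : AddSubgroup V) (S : Finset V) (hS : (S : Set V) ⊆ Λ)
    (l : V →ₗ[ℝ] ℝ) (hl : ∀ x ∈ Λ, ∀ y ∈ Λ, l x • y ∈ Λ) :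
    ∃ S' : Finset V, (S' : Set V) ⊆ Λ ∧ ∀ x, x ∈ PointedCone.hull ℝ (S' : Set V) ↔
      x ∈ PointedCone.hull ℝ (S : Set V) ∧ 0 ≤ l x := by
  classical
  set A := S.filter fun s => 0 ≤ l s with hA
  set B := S.filter fun s => l s < 0 with hB
  -- As in Fourier–Motzkin elimination, a generator t on the negative side enters only through its
  -- combinations with generators s of the other side that lie on the hyperplane l = 0.
  set S' : Finset V := A ∪ Finset.image₂ (fun s t => l s • t - l t • s) A B with hS'
  have hAS' : (A : Set V) ⊆ S' := by rw [hS', Finset.coe_union]; exact Set.subset_union_left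
  have hAB : ∀ s ∈ A, ∀ t ∈ B, l s • t - l t • s ∈ PointedCone.hull ℝ (S' : Set V) :=
    fun s hs t ht => Submodule.subset_span <| by
      rw [Finset.mem_coe, hS']
      exact Finset.mem_union_right _ (Finset.mem_image₂_of_mem hs ht)
  have hA0 : ∀ p ∈ PointedCone.hull ℝ (A : Set V), 0 ≤ l p := by
    intro p hp
    induction hp using Submodule.span_induction with
    | mem x hx => exact (Finset.mem_filter.1 hx).2
    | zero => simp
    | add x y _ _ hx hy => rw [map_add]; exact add_nonneg hx hy
    | smul a x _ hx => exact (map_smul l (a : ℝ) x).symm ▸ mul_nonneg a.2 hx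
  have hB0 : ∀ q ∈ PointedCone.hull ℝ (B : Set V), q = 0 ∨ l q < 0 := by
    intro p hp
    induction hp using Submodule.span_induction with
    | mem x hx => exact Or.inr (Finset.mem_filter.1 hx).2
    | zero => exact Or.inl rfl
    | add x y _ _ hx hy =>
      rcases hx with rfl | hx
      · simpa using hy
      · rcases hy with rfl | hy
        · right; simpa using hx
        · right; rw [map_add]; exact add_neg hx hy
    | smul a x _ hx =>
      rcases hx with rfl | hx
      · left; simp
      · rcases eq_or_lt_of_le a.2 with h | h
        · left
          have : a = 0 := Subtype.ext h.symm
          rw [this, zero_smul]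
        · right; exact (map_smul l (a : ℝ) x).symm ▸ mul_neg_of_pos_of_neg h hx
  -- The expression is bilinear in p and q, so membership extends from pairs of generators.
  have hbil : ∀ p ∈ PointedCone.hull ℝ (A : Set V), ∀ q ∈ PointedCone.hull ℝ (B : Set V),
      l p • q - l q • p ∈ PointedCone.hull ℝ (S' : Set V) := by
    intro p hp q hq
    induction hp using Submodule.span_induction with
    | mem s hs =>
      induction hq using Submodule.span_induction with
      | mem t ht => exact hAB s hs t ht
      | zero => simp
      | add x y _ _ hx hy =>
        have := add_mem hx hy
        convert this using 1
        rw [map_add]; module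
      | smul a x _ hx =>
        have := smul_mem_cone _ a.2 hx
        convert this using 1
        change l s • ((a : ℝ) • x) - l ((a : ℝ) • x) • s = _
        rw [map_smul, smul_eq_mul]; module
    | zero => simp
    | add x y _ _ hx hy =>
      have := add_mem hx hy
      convert this using 1
      rw [map_add]; module
    | smul a x _ hx =>
      have := smul_mem_cone _ a.2 hx
      convert this using 1
      change l ((a : ℝ) • x) • q - l q • ((a : ℝ) • x) = _
      rw [map_smul, smul_eq_mul]; module
  refine ⟨S', ?_, fun x => ⟨fun hx => ?_, ?_⟩⟩
  · intro x hx
    rcases Finset.mem_union.1 hx with hx | hx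
    · exact hS (Finset.mem_filter.1 hx).1
    · obtain ⟨s, hs, t, ht, rfl⟩ := Finset.mem_image₂.1 hx
      have hs' := hS (Finset.mem_filter.1 hs).1
      have ht' := hS (Finset.mem_filter.1 ht).1
      exact sub_mem (hl s hs' t ht') (hl t ht' s hs')
  · induction hx using Submodule.span_induction with
    | mem x hx =>
      rcases Finset.mem_union.1 hx with hx | hx
      · exact ⟨Submodule.subset_span (Finset.mem_filter.1 hx).1, (Finset.mem_filter.1 hx).2⟩
      · obtain ⟨s, hs, t, ht, rfl⟩ := Finset.mem_image₂.1 hx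
        rw [Finset.mem_filter] at hs ht
        constructor
        · rw [sub_eq_add_neg, ← neg_smul]
          exact add_mem (smul_mem_cone _ hs.2 (Submodule.subset_span ht.1))
            (smul_mem_cone _ (neg_nonneg.2 ht.2.le) (Submodule.subset_span hs.1))
        · simp only [map_sub, map_smul, smul_eq_mul]
          linarith [mul_comm (l s) (l t)]
    | zero => exact ⟨Submodule.zero_mem _, by simp⟩
    | add x y _ _ hx hy => exact ⟨add_mem hx.1 hy.1, by rw [map_add]; exact add_nonneg hx.2 hy.2⟩
    | smul a x _ hx =>
      exact ⟨smul_mem_cone _ a.2 hx.1, (map_smul l (a : ℝ) x).symm ▸ mul_nonneg a.2 hx.2⟩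
  · rintro ⟨hx, hlx⟩
    have hSAB : (S : Set V) = (A : Set V) ∪ (B : Set V) := by
      rw [← Finset.coe_union, hA, hB]
      simp only [← not_le]
      rw [Finset.filter_union_filter_not_eq]
    rw [hSAB] at hx
    replace hx : x ∈ PointedCone.hull ℝ (A : Set V) ⊔ PointedCone.hull ℝ (B : Set V) := by
      rw [PointedCone.hull, PointedCone.hull, ← Submodule.span_union]; exact hx
    rw [Submodule.mem_sup] at hx
    obtain ⟨p, hp, q, hq, rfl⟩ := hx
    have hpS : p ∈ PointedCone.hull ℝ (S' : Set V) := Submodule.span_mono hAS' hp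
    rcases hB0 q hq with rfl | hq0
    · simpa using hpS
    · have hp0 : 0 < l p := by rw [map_add] at hlx; linarith
      -- The positive multiple l(p)·(p + q) equals (l(p)q − l(q)p) + l(p + q)p, a sum of two
      -- elements of the new cone.
      have h1 := add_mem (hbil p hp q hq) (smul_mem_cone _ hlx hpS)
      have h2 := smul_mem_cone _ (inv_nonneg.2 hp0.le) h1
      convert h2 using 1
      rw [map_add]
      have : l p • q - l q • p + (l p + l q) • p = l p • (p + q) := by module
      rw [this, inv_smul_smul₀ hp0.ne']

/-- The double description method: a cone cut out of a finitely generated cone by finitely many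
half spaces is finitely generated, by elements of `Λ`. -/
theorem exists_hull_eq_halfSpaces {κ : Type*} (Λ : AddSubgroup V) (S : Finset V)
    (hS : (S : Set V) ⊆ Λ) (s : Finset κ) (l : κ → V →ₗ[ℝ] ℝ)
    (hl : ∀ i ∈ s, ∀ x ∈ Λ, ∀ y ∈ Λ, l i x • y ∈ Λ) :
    ∃ S' : Finset V, (S' : Set V) ⊆ Λ ∧ ∀ x, x ∈ PointedCone.hull ℝ (S' : Set V) ↔
      x ∈ PointedCone.hull ℝ (S : Set V) ∧ ∀ i ∈ s, 0 ≤ l i x := by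
  classical
  induction s using Finset.induction_on with
  | empty => exact ⟨S, hS, by simp⟩
  | insert m s hm ih =>
    obtain ⟨S₁, h₁, h₂⟩ := ih fun i hi => hl i (Finset.mem_insert_of_mem hi)
    obtain ⟨S₂, h₃, h₄⟩ := exists_hull_eq_halfSpace Λ S₁ h₁ (l m) (hl m (Finset.mem_insert_self _ _))
    refine ⟨S₂, h₃, fun x => ?_⟩
    rw [h₄, h₂, Finset.forall_mem_insert]
    tauto

/-- The vectors with integral coordinates. -/
def integralVectors (κ : Type*) : AddSubgroup (κ → ℝ) where
  carrier := {x | ∀ i, ∃ k : ℤ, (k : ℝ) = x i}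
  zero_mem' _ := ⟨0, by simp⟩
  add_mem' hx hy i := by
    obtain ⟨k, hk⟩ := hx i
    obtain ⟨m, hm⟩ := hy i
    exact ⟨k + m, by simp [hk, hm]⟩
  neg_mem' hx i := by
    obtain ⟨k, hk⟩ := hx i
    exact ⟨-k, by simp [hk]⟩

/-- The starting point for `exists_hull_eq_halfSpaces` when a cone is given by half spaces alone. -/
theorem exists_hull_eq_top (κ : Type*) [Finite κ] :
    ∃ S : Finset (κ → ℝ), (S : Set (κ → ℝ)) ⊆ integralVectors κ ∧
      ∀ x, x ∈ PointedCone.hull ℝ (S : Set (κ → ℝ)) := by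
  classical
  cases nonempty_fintype κ
  have hint : ∀ j : κ, (Pi.single j 1 : κ → ℝ) ∈ integralVectors κ := by
    intro j i
    by_cases h : i = j
    · subst h; exact ⟨1, by simp⟩
    · exact ⟨0, by simp [h]⟩
  refine ⟨Finset.univ.image (fun j => Pi.single j 1) ∪
    Finset.univ.image (fun j => -Pi.single j 1), ?_, fun x => ?_⟩
  · intro x hx
    simp only [Finset.coe_union, Finset.coe_image, Finset.coe_univ, Set.image_univ,
      Set.mem_union, Set.mem_range] at hx
    rcases hx with ⟨j, rfl⟩ | ⟨j, rfl⟩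
    · exact hint j
    · exact neg_mem (hint j)
  · have hx : x = ∑ j, x j • (Pi.single j 1 : κ → ℝ) := by
      ext i
      simp [Finset.sum_apply, Pi.single_apply]
    rw [hx]
    refine Submodule.sum_mem _ fun j _ => ?_
    rcases le_total 0 (x j) with h | h
    · exact smul_mem_cone _ h (Submodule.subset_span (by simp))
    · have := smul_mem_cone (PointedCone.hull ℝ _) (neg_nonneg.2 h)
        (Submodule.subset_span (show -(Pi.single j 1 : κ → ℝ) ∈
          ((Finset.univ.image (fun j => Pi.single j 1) ∪
            Finset.univ.image (fun j => -Pi.single j 1) : Finset (κ → ℝ)) : Set (κ → ℝ)) by simp))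
      simpa using this

/-- A cone which is a finite union of faces equals one of them. -/
theorem exists_eq_of_subset_iUnion_faces {κ : Type*} (s : Finset κ) (F : κ → PointedCone ℝ V)
    (C : PointedCone ℝ V) (hF : ∀ i ∈ s, (F i).IsFaceOf C)
    (hC : ∀ x ∈ C, ∃ i ∈ s, x ∈ F i) : ∃ i ∈ s, F i = C := by
  classical
  by_contra! hcon
  have : ∀ i, ∃ x, i ∈ s → x ∈ C ∧ x ∉ F i := by
    intro i
    by_cases hi : i ∈ s
    · have h1 : ¬ C ≤ F i := fun h => hcon i hi (le_antisymm (hF i hi).le h)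
      obtain ⟨x, hx, hx'⟩ := SetLike.not_le_iff_exists.1 h1
      exact ⟨x, fun _ => ⟨hx, hx'⟩⟩
    · exact ⟨0, fun h => absurd h hi⟩
  choose x hx using this
  -- Each summand lies in C but outside its own face, while a face containing the sum would contain
  -- every summand.
  obtain ⟨i, hi, hmem⟩ := hC (∑ i ∈ s, x i) (Submodule.sum_mem _ fun i hi => (hx i hi).1)
  rw [← Finset.add_sum_erase s x hi] at hmem
  exact (hx i hi).2 ((hF i hi).mem_of_add_mem_left (hx i hi).1
    (Submodule.sum_mem _ fun j hj => (hx j (Finset.mem_of_mem_erase hj)).1) hmem)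

end Cones

end GKZ

namespace GKZ

/-! ### Faces of the polyhedra of a vector configuration -/

section Configuration

variable {ι : Type*} {n : ℕ} {g : ι → Fin n → ℝ}

theorem map_hull {V W : Type*} [AddCommGroup V] [Module ℝ V] [AddCommGroup W] [Module ℝ W]
    (f : V →ₗ[ℝ] W) (s : Set V) :
    PointedCone.map f (PointedCone.hull ℝ s) = PointedCone.hull ℝ (f '' s) :=
  Submodule.map_span (f.restrictScalars {c : ℝ // 0 ≤ c}) s

/-- The linear functional `u ↦ ⟨u, v⟩`. -/
def pairing (v : Fin n → ℝ) : (Fin n → ℝ) →ₗ[ℝ] ℝ where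
  toFun u := u ⬝ᵥ v
  map_add' u w := add_dotProduct u w v
  map_smul' c u := by simp [smul_dotProduct]

@[simp]
theorem pairing_apply (v u : Fin n → ℝ) : pairing v u = u ⬝ᵥ v := rfl

theorem dotProduct_sum_smul [Fintype ι] (u : Fin n → ℝ) (c : ι → ℝ) :
    u ⬝ᵥ (∑ i, c i • g i) = ∑ i, c i * (u ⬝ᵥ g i) := by
  simp [dotProduct_sum, dotProduct_smul]

variable (g) in
/-- The polyhedron `{u : ⟨u, g i⟩ ≥ -D i for all i}`. -/
def poly (D : ι → ℝ) : Set (Fin n → ℝ) := {u | ∀ i, -D i ≤ u ⬝ᵥ g i}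

variable (g) in
/-- The inequalities of `poly g D` that are equalities at `u`. -/
def tightSet (D : ι → ℝ) (u : Fin n → ℝ) : Set ι := {i | u ⬝ᵥ g i = -D i}

variable (g) in
/-- The inequalities indexed by `K` are equalities at a common point of `poly g D`. -/
def IsFaceSet (D : ι → ℝ) (K : Set ι) : Prop := ∃ u ∈ poly g D, K ⊆ tightSet g D u

variable (g) in
/-- The normal cone of `poly g D` at `u`. -/
def normalConeAt (D : ι → ℝ) (u : Fin n → ℝ) : PointedCone ℝ (Fin n → ℝ) :=
  PointedCone.hull ℝ (g '' tightSet g D u)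

theorem isFaceSet_tightSet {D : ι → ℝ} {u : Fin n → ℝ} (hu : u ∈ poly g D) :
    IsFaceSet g D (tightSet g D u) := ⟨u, hu, subset_rfl⟩

theorem IsFaceSet.nonempty {D : ι → ℝ} {K : Set ι} (h : IsFaceSet g D K) :
    (poly g D).Nonempty := by
  obtain ⟨u, hu, -⟩ := h
  exact ⟨u, hu⟩

/-- Nonemptiness is itself a face set condition, so it passes from D to all members of its chamber.
-/
theorem isFaceSet_empty_iff {D : ι → ℝ} : IsFaceSet g D ∅ ↔ (poly g D).Nonempty :=
  ⟨IsFaceSet.nonempty, fun ⟨u, hu⟩ => ⟨u, hu, Set.empty_subset _⟩⟩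

theorem add_mem_poly {D E : ι → ℝ} {u w : Fin n → ℝ} (hu : u ∈ poly g D) (hw : w ∈ poly g E) :
    u + w ∈ poly g (D + E) := by
  intro i
  have h1 := hu i
  have h2 := hw i
  rw [add_dotProduct, Pi.add_apply]
  linarith

theorem inter_tightSet_subset {D E : ι → ℝ} (u w : Fin n → ℝ) :
    tightSet g D u ∩ tightSet g E w ⊆ tightSet g (D + E) (u + w) := by
  rintro i ⟨h1, h2⟩
  simp only [tightSet, Set.mem_ofPred_eq, add_dotProduct, Pi.add_apply] at h1 h2 ⊢
  linarith

theorem IsFaceSet.add {D E : ι → ℝ} {K : Set ι} (hD : IsFaceSet g D K) (hE : IsFaceSet g E K) :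
    IsFaceSet g (D + E) K := by
  obtain ⟨u, hu, huK⟩ := hD
  obtain ⟨w, hw, hwK⟩ := hE
  exact ⟨u + w, add_mem_poly hu hw,
    (Set.subset_inter huK hwK).trans (inter_tightSet_subset u w)⟩

theorem IsFaceSet.smul {D : ι → ℝ} {K : Set ι} (hD : IsFaceSet g D K) {c : ℝ} (hc : 0 ≤ c) :
    IsFaceSet g (c • D) K := by
  obtain ⟨u, hu, huK⟩ := hD
  refine ⟨c • u, fun i => ?_, fun i hi => ?_⟩
  · have := mul_le_mul_of_nonneg_left (hu i) hc
    simpa [smul_dotProduct] using this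
  · have : u ⬝ᵥ g i = -D i := huK hi
    simp [tightSet, smul_dotProduct, this]

theorem isFaceSet_zero (K : Set ι) : IsFaceSet g 0 K :=
  ⟨0, fun i => by simp, fun i _ => by simp [tightSet]⟩

theorem IsFaceSet.add_linear {D : ι → ℝ} {K : Set ι} (hD : IsFaceSet g D K) (w : Fin n → ℝ) :
    IsFaceSet g (D + fun i => w ⬝ᵥ g i) K := by
  refine hD.add ⟨-w, fun i => ?_, fun i _ => ?_⟩ <;> simp [tightSet, neg_dotProduct]

/-- Adding a linear function to D only translates the polyhedron; this makes face sets an invariant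
of the divisor class. -/
theorem isFaceSet_add_linear {D : ι → ℝ} {K : Set ι} (w : Fin n → ℝ) :
    IsFaceSet g (D + fun i => w ⬝ᵥ g i) K ↔ IsFaceSet g D K := by
  refine ⟨fun h => ?_, fun h => h.add_linear w⟩
  have := h.add_linear (-w)
  convert this using 1
  ext i
  simp [neg_dotProduct]

variable (g) in
/-- The cone of all `E` such that each face set of `D` is one of `E`. -/
def chamber (D : ι → ℝ) : PointedCone ℝ (ι → ℝ) where
  carrier := {E | ∀ K, IsFaceSet g D K → IsFaceSet g E K}
  add_mem' hE hF K hK := (hE K hK).add (hF K hK)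
  zero_mem' K _ := isFaceSet_zero K
  smul_mem' c _ hE K hK := (hE K hK).smul c.2

theorem mem_chamber {D E : ι → ℝ} :
    E ∈ chamber g D ↔ ∀ K, IsFaceSet g D K → IsFaceSet g E K := Iff.rfl

theorem self_mem_chamber (D : ι → ℝ) : D ∈ chamber g D := fun _ h => h

theorem chamber_le_chamber {D E : ι → ℝ} (h : E ∈ chamber g D) : chamber g E ≤ chamber g D :=
  fun _ hF K hK => hF K (h K hK)

theorem add_linear_mem_chamber {D E : ι → ℝ} (w : Fin n → ℝ) :
    (E + fun i => w ⬝ᵥ g i) ∈ chamber g D ↔ E ∈ chamber g D := by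
  simp only [mem_chamber, isFaceSet_add_linear]

theorem poly_nonempty_of_mem_chamber {D E : ι → ℝ} (hD : (poly g D).Nonempty)
    (hE : E ∈ chamber g D) : (poly g E).Nonempty :=
  isFaceSet_empty_iff.1 (hE _ (isFaceSet_empty_iff.2 hD))

theorem eventually_add_mul_pos [Finite ι] (f h : ι → ℝ) :
    ∀ᶠ ε in nhdsWithin (0 : ℝ) (Set.Ioi 0), ∀ i, 0 < f i → 0 < f i + ε * h i := by
  refine Filter.eventually_all.2 fun i => ?_
  by_cases hi : 0 < f i
  · have hc : Continuous fun ε : ℝ => f i + ε * h i := by fun_prop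
    have := (hc.tendsto 0).eventually_const_lt (u := 0) (by simpa using hi)
    filter_upwards [nhdsWithin_le_nhds this] with ε hε _ using hε
  · exact Filter.Eventually.of_forall fun ε h => absurd h hi

theorem exists_pos_of_eventually {p : ℝ → Prop}
    (h : ∀ᶠ ε in nhdsWithin (0 : ℝ) (Set.Ioi 0), p ε) : ∃ ε, 0 < ε ∧ p ε := by
  obtain ⟨ε, h1, h2⟩ := (h.and self_mem_nhdsWithin).exists
  exact ⟨ε, h2, h1⟩

/-- `chamber g D` is a neighbourhood of `D` in the space of those `E` that are linear on the
normal cones of `poly g D`. -/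
theorem eventually_add_smul_mem_chamber [Finite ι] {D E : ι → ℝ}
    (hE : ∀ K, IsFaceSet g D K → ∃ w : Fin n → ℝ, ∀ i ∈ K, w ⬝ᵥ g i = -E i) :
    ∀ᶠ ε in nhdsWithin (0 : ℝ) (Set.Ioi 0), D + ε • E ∈ chamber g D := by
  simp only [mem_chamber]
  refine Filter.eventually_all.2 fun K => ?_
  by_cases hK : IsFaceSet g D K
  swap
  · exact Filter.Eventually.of_forall fun ε h => absurd h hK
  obtain ⟨u, hu, huK⟩ := hK
  obtain ⟨w, hw⟩ := hE _ (isFaceSet_tightSet hu)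
  filter_upwards [eventually_add_mul_pos (fun i => u ⬝ᵥ g i + D i) (fun i => w ⬝ᵥ g i + E i)]
    with ε hε _
  have htight : ∀ i ∈ tightSet g D u, (u + ε • w) ⬝ᵥ g i = -(D + ε • E) i := by
    intro i hi
    have h1 : u ⬝ᵥ g i = -D i := hi
    simp only [add_dotProduct, smul_dotProduct, h1, hw i hi, Pi.add_apply, Pi.smul_apply,
      smul_eq_mul]
    ring
  refine ⟨u + ε • w, fun i => ?_, fun i hi => htight i (huK hi)⟩
  by_cases hi : i ∈ tightSet g D u
  · exact (htight i hi).ge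
  · have h1 : 0 < u ⬝ᵥ g i + D i := by
      have h2 := hu i
      have h3 : u ⬝ᵥ g i ≠ -D i := hi
      have := lt_of_le_of_ne h2 (Ne.symm h3)
      linarith
    have := hε i h1
    simp only [add_dotProduct, smul_dotProduct, Pi.add_apply, Pi.smul_apply, smul_eq_mul]
    linarith

/-- Both D and D + εE lie in the chamber for some ε > 0, and their difference is εE. -/
theorem mem_span_chamber [Finite ι] {D E : ι → ℝ}
    (hE : ∀ K, IsFaceSet g D K → ∃ w : Fin n → ℝ, ∀ i ∈ K, w ⬝ᵥ g i = -E i) :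
    E ∈ Submodule.span ℝ (chamber g D : Set (ι → ℝ)) := by
  obtain ⟨ε, hε, h⟩ := exists_pos_of_eventually (eventually_add_smul_mem_chamber hE)
  have h1 := Submodule.sub_mem _ (Submodule.subset_span (R := ℝ) h)
    (Submodule.subset_span (R := ℝ) (self_mem_chamber D))
  rw [add_sub_cancel_left] at h1
  have h2 := Submodule.smul_mem _ ε⁻¹ h1
  rwa [inv_smul_smul₀ hε.ne'] at h2

/-! ### Linear programming duality and normal cones. -/

variable [Fintype ι]

/-- Farkas' lemma for the cone generated by a subfamily of the configuration. -/
theorem mem_hull_image_of_forall {K : Set ι} {x : Fin n → ℝ}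
    (h : ∀ u : Fin n → ℝ, (∀ i ∈ K, 0 ≤ u ⬝ᵥ g i) → 0 ≤ u ⬝ᵥ x) :
    x ∈ PointedCone.hull ℝ (g '' K) := by
  classical
  obtain ⟨c, hc, hx⟩ := farkas K.toFinset (fun i => pairing (g i)) (pairing x)
    (fun u hu => h u fun i hi => hu i (by simpa using hi))
  have : x = ∑ i ∈ K.toFinset, c i • g i := by
    ext j
    have := LinearMap.congr_fun hx (Pi.single j 1)
    simpa [Finset.sum_apply] using this
  rw [this]
  exact Submodule.sum_mem _ fun i hi =>
    smul_mem_cone _ (hc i) (Submodule.subset_span ⟨i, by simpa using hi, rfl⟩)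

theorem dotProduct_nonneg_of_mem_hull {K : Set ι} {w x : Fin n → ℝ}
    (hw : ∀ i ∈ K, 0 ≤ w ⬝ᵥ g i) (hx : x ∈ PointedCone.hull ℝ (g '' K)) : 0 ≤ w ⬝ᵥ x := by
  obtain ⟨c, hc, hcK, rfl⟩ := mem_hull_image.1 hx
  rw [dotProduct_sum_smul]
  refine Finset.sum_nonneg fun i _ => ?_
  by_cases hi : i ∈ K
  · exact mul_nonneg (hc i) (hw i hi)
  · simp [hcK i hi]

theorem dotProduct_eq_of_mem_hull {K : Set ι} {u w x : Fin n → ℝ}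
    (hw : ∀ i ∈ K, u ⬝ᵥ g i = w ⬝ᵥ g i) (hx : x ∈ PointedCone.hull ℝ (g '' K)) :
    u ⬝ᵥ x = w ⬝ᵥ x := by
  have h1 := dotProduct_nonneg_of_mem_hull (w := u - w) (K := K)
    (fun i hi => by rw [sub_dotProduct, hw i hi, sub_self]) hx
  have h2 := dotProduct_nonneg_of_mem_hull (w := w - u) (K := K)
    (fun i hi => by rw [sub_dotProduct, hw i hi, sub_self]) hx
  rw [sub_dotProduct] at h1 h2
  linarith

theorem dotProduct_le_of_mem_hull {D : ι → ℝ} {K : Set ι} {u w x : Fin n → ℝ}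
    (hK : K ⊆ tightSet g D u) (hw : w ∈ poly g D) (hx : x ∈ PointedCone.hull ℝ (g '' K)) :
    u ⬝ᵥ x ≤ w ⬝ᵥ x := by
  have h1 := dotProduct_nonneg_of_mem_hull (w := w - u) (K := K)
    (fun i hi => by
      have h2 : u ⬝ᵥ g i = -D i := hK hi
      have := hw i
      rw [sub_dotProduct]
      linarith) hx
  rw [sub_dotProduct] at h1
  linarith

/-- A linear functional in the cone generated by the configuration has a minimum on a nonempty
polyhedron. -/
theorem exists_isMin {D : ι → ℝ} (hD : (poly g D).Nonempty) {x : Fin n → ℝ}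
    (hx : x ∈ PointedCone.hull ℝ (Set.range g)) :
    ∃ u ∈ poly g D, ∀ w ∈ poly g D, u ⬝ᵥ x ≤ w ⬝ᵥ x := by
  classical
  -- Homogenization: the polyhedron is the slice `y none = 1` of the cone cut out by these
  -- functionals. Finitely many generators of that cone reduce the minimum to a finite one.
  let l : Option ι → (Option (Fin n) → ℝ) →ₗ[ℝ] ℝ := fun o => match o with
    | none => LinearMap.proj none
    | some i => pairing (g i) ∘ₗ LinearMap.funLeft ℝ ℝ some + D i • LinearMap.proj none
  have hln : ∀ y, l none y = y none := fun y => rfl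
  have hls : ∀ i y, l (some i) y = (y ∘ some) ⬝ᵥ g i + D i * y none := fun i y => rfl
  obtain ⟨S₀, -, hS₀⟩ := exists_hull_eq_top (Option (Fin n))
  obtain ⟨S, -, hS⟩ := exists_hull_eq_halfSpaces ⊤ S₀ (by simp) Finset.univ l (by simp)
  have hSmem : ∀ s ∈ S, 0 ≤ s none ∧ ∀ i, 0 ≤ (s ∘ some) ⬝ᵥ g i + D i * s none := by
    intro s hs
    have := ((hS s).1 (Submodule.subset_span hs)).2
    exact ⟨hln s ▸ this none (Finset.mem_univ _), fun i => hls i s ▸ this (some i) (Finset.mem_univ _)⟩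
  have hlift : ∀ w ∈ poly g D, ∃ y ∈ PointedCone.hull ℝ (S : Set (Option (Fin n) → ℝ)),
      y none = 1 ∧ y ∘ some = w := by
    intro w hw
    refine ⟨fun o => o.elim 1 w, (hS _).2 ⟨hS₀ _, fun o _ => ?_⟩, rfl, rfl⟩
    cases o with
    | none => rw [hln]; exact zero_le_one
    | some i =>
      rw [hls]
      have := hw i
      change 0 ≤ w ⬝ᵥ g i + D i * 1
      linarith
  obtain ⟨c, hc, -, hxc⟩ := mem_hull_image.1 (Set.image_univ (f := g) ▸ hx)
  -- Generators with positive extra coordinate rescale to points of the polyhedron; the others are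
  -- recession directions.
  set T := S.filter fun s => 0 < s none with hT
  have hTne : T.Nonempty := by
    by_contra hcon
    rw [Finset.not_nonempty_iff_eq_empty, Finset.filter_eq_empty_iff] at hcon
    obtain ⟨w, hw⟩ := hD
    obtain ⟨y, hy, hy1, -⟩ := hlift w hw
    have : ∀ y ∈ PointedCone.hull ℝ (S : Set (Option (Fin n) → ℝ)), y none = 0 := by
      intro y hy
      induction hy using Submodule.span_induction with
      | mem s hs => exact le_antisymm (not_lt.1 (hcon hs)) (hSmem s hs).1
      | zero => rfl
      | add y z _ _ hy hz => simp [hy, hz]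
      | smul a y _ hy => change (a : ℝ) * y none = 0; simp [hy]
    rw [this y hy] at hy1
    exact zero_ne_one hy1
  obtain ⟨s, hs, hmin⟩ := Finset.exists_min_image T
    (fun s => (s none)⁻¹ * ((s ∘ some) ⬝ᵥ x)) hTne
  rw [hT, Finset.mem_filter] at hs
  set m := (s none)⁻¹ * ((s ∘ some) ⬝ᵥ x) with hm
  -- Along recession directions the functional is nonnegative because x is a nonnegative combination
  -- of the `g i`, so the bound m from the generators in T holds on the whole cone.
  have key : ∀ y ∈ PointedCone.hull ℝ (S : Set (Option (Fin n) → ℝ)),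
      m * y none ≤ (y ∘ some) ⬝ᵥ x := by
    intro y hy
    induction hy using Submodule.span_induction with
    | mem t ht =>
      rcases eq_or_lt_of_le (hSmem t ht).1 with h0 | h0
      · rw [← h0, mul_zero, hxc, dotProduct_sum_smul]
        refine Finset.sum_nonneg fun i _ => mul_nonneg (hc i) ?_
        have := (hSmem t ht).2 i
        rwa [← h0, mul_zero, add_zero] at this
      · have := hmin t (Finset.mem_filter.2 ⟨ht, h0⟩)
        rw [inv_mul_eq_div, le_div_iff₀ h0] at this
        exact this
    | zero => simp
    | add y z _ _ hy hz =>
      change m * (y none + z none) ≤ (y ∘ some + z ∘ some) ⬝ᵥ x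
      rw [add_dotProduct]; linarith
    | smul a y _ hy =>
      change m * ((a : ℝ) * y none) ≤ ((a : ℝ) • (y ∘ some)) ⬝ᵥ x
      rw [smul_dotProduct, smul_eq_mul]
      have := mul_le_mul_of_nonneg_left hy a.2
      linarith
  refine ⟨(s none)⁻¹ • (s ∘ some), fun i => ?_, fun w hw => ?_⟩
  · have := (hSmem s hs.1).2 i
    rw [smul_dotProduct, smul_eq_mul, inv_mul_eq_div, le_div_iff₀ hs.2]
    linarith
  · obtain ⟨y, hy, hy1, rfl⟩ := hlift w hw
    have := key y hy
    rw [smul_dotProduct, smul_eq_mul]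
    rwa [hy1, mul_one] at this

/-- Linear programming duality: the normal cones of a nonempty polyhedron cover the cone
generated by the configuration. -/
theorem exists_mem_normalConeAt {D : ι → ℝ} (hD : (poly g D).Nonempty) {x : Fin n → ℝ}
    (hx : x ∈ PointedCone.hull ℝ (Set.range g)) : ∃ u ∈ poly g D, x ∈ normalConeAt g D u := by
  obtain ⟨u, hu, hmin⟩ := exists_isMin hD hx
  -- By Farkas it suffices to test each w that is nonnegative on the generators tight at u. A small
  -- step from u along w stays in the polyhedron, so minimality of u gives ⟨w, x⟩ ≥ 0.
  refine ⟨u, hu, mem_hull_image_of_forall fun w hw => ?_⟩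
  obtain ⟨ε, hε, h⟩ := exists_pos_of_eventually
    (eventually_add_mul_pos (fun i => u ⬝ᵥ g i + D i) (fun i => w ⬝ᵥ g i))
  have := hmin (u + ε • w) (fun i => by
    rw [add_dotProduct, smul_dotProduct, smul_eq_mul]
    by_cases hi : i ∈ tightSet g D u
    · have h1 : u ⬝ᵥ g i = -D i := hi
      have := mul_nonneg hε.le (hw i hi)
      linarith
    · have := h i (by
        have := lt_of_le_of_ne (hu i) (Ne.symm hi)
        linarith)
      linarith)
  rw [add_dotProduct, smul_dotProduct, smul_eq_mul, le_add_iff_nonneg_right] at this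
  exact nonneg_of_mul_nonneg_right this hε

/-- Complementary slackness. -/
theorem mem_tightSet_of_dotProduct_le {D : ι → ℝ} {u w : Fin n → ℝ} (hw : w ∈ poly g D)
    {c : ι → ℝ} (hc : ∀ i, 0 ≤ c i) (hcK : ∀ i ∉ tightSet g D u, c i = 0)
    (h : w ⬝ᵥ (∑ i, c i • g i) ≤ u ⬝ᵥ (∑ i, c i • g i)) {i : ι} (hi : c i ≠ 0) :
    i ∈ tightSet g D w := by
  rw [dotProduct_sum_smul, dotProduct_sum_smul] at h
  have hnn : ∀ i, c i * (u ⬝ᵥ g i) ≤ c i * (w ⬝ᵥ g i) := by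
    intro i
    by_cases hiK : i ∈ tightSet g D u
    · have h1 : u ⬝ᵥ g i = -D i := hiK
      exact mul_le_mul_of_nonneg_left (h1 ▸ hw i) (hc i)
    · simp [hcK i hiK]
  have heq := (Finset.sum_eq_sum_iff_of_le fun i _ => hnn i).1
    (le_antisymm (Finset.sum_le_sum fun i _ => hnn i) h) i (Finset.mem_univ _)
  have hiK : i ∈ tightSet g D u := by
    by_contra hcon
    exact hi (hcK i hcon)
  have h1 : u ⬝ᵥ g i = -D i := hiK
  exact (mul_left_cancel₀ hi heq).symm.trans h1

theorem mem_normalConeAt_iff {D : ι → ℝ} {u : Fin n → ℝ} (hu : u ∈ poly g D) {x : Fin n → ℝ} :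
    x ∈ normalConeAt g D u ↔
      x ∈ PointedCone.hull ℝ (Set.range g) ∧ ∀ w ∈ poly g D, u ⬝ᵥ x ≤ w ⬝ᵥ x := by
  constructor
  · intro hx
    exact ⟨Submodule.span_mono (Set.image_subset_range _ _) hx,
      fun w hw => dotProduct_le_of_mem_hull subset_rfl hw hx⟩
  · rintro ⟨hx, hmin⟩
    -- Duality places x in the normal cone of some w. Since u attains the same minimum,
    -- complementary slackness shows that the generators used are tight at u too.
    obtain ⟨w, hw, hxw⟩ := exists_mem_normalConeAt ⟨u, hu⟩ hx
    obtain ⟨c, hc, hcK, rfl⟩ := mem_hull_image.1 hxw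
    refine mem_hull_image.2 ⟨c, hc, fun i hi => ?_, rfl⟩
    by_contra hcon
    exact hi (mem_tightSet_of_dotProduct_le hu hc hcK (hmin w hw) hcon)

/-- A point of a polyhedron that minimizes the sum of the `g i`, `i ∈ K`, is tight on `K`,
if some point is. -/
theorem subset_tightSet_of_dotProduct_le {D : ι → ℝ} {u w : Fin n → ℝ} (hw : w ∈ poly g D)
    {K : Set ι} [DecidablePred (· ∈ K)] (hK : K ⊆ tightSet g D u)
    (h : w ⬝ᵥ (∑ i, (if i ∈ K then (1 : ℝ) else 0) • g i) ≤
      u ⬝ᵥ (∑ i, (if i ∈ K then (1 : ℝ) else 0) • g i)) : K ⊆ tightSet g D w := by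
  intro i hi
  refine mem_tightSet_of_dotProduct_le hw (fun i => ?_) (fun i hi => ?_) h (i := i) (by simp [hi])
  · split_ifs <;> simp
  · rw [if_neg fun h => hi (hK h)]

/-- All weights on K are positive, so this one vector tests K as a whole: if some point of a
polyhedron is tight on K, every minimizer of the vector is. -/
theorem sum_ite_mem_hull (K : Set ι) [DecidablePred (· ∈ K)] :
    ∑ i, (if i ∈ K then (1 : ℝ) else 0) • g i ∈ PointedCone.hull ℝ (g '' K) :=
  mem_hull_image.2 ⟨_, fun i => by split_ifs <;> simp, fun i hi => by simp [hi], rfl⟩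

/-- If the support functions of `x` and `y` are linear on the normal cones of one polyhedron,
then a face of the polyhedron of `x + y` comes from faces of those of `x` and `y`. -/
theorem IsFaceSet.of_add {D x y : ι → ℝ} (hD : (poly g D).Nonempty) (hx : x ∈ chamber g D)
    (hy : y ∈ chamber g D) {K : Set ι} (h : IsFaceSet g (x + y) K) : IsFaceSet g x K := by
  classical
  obtain ⟨u, hu, huK⟩ := h
  -- This vector v lies in one normal cone of `poly g D`, on whose generators x and y have tight
  -- points a and b. Then a + b minimizes v for x + y, so it is tight on K, and the nonnegative
  -- slacks of a and b on K add up to 0.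
  have hv := sum_ite_mem_hull (g := g) K
  obtain ⟨w, hw, hvw⟩ := exists_mem_normalConeAt hD
    (Submodule.span_mono (Set.image_subset_range _ _) hv)
  obtain ⟨a, ha, haK⟩ := hx _ (isFaceSet_tightSet hw)
  obtain ⟨b, hb, hbK⟩ := hy _ (isFaceSet_tightSet hw)
  have h1 := dotProduct_le_of_mem_hull
    ((Set.subset_inter haK hbK).trans (inter_tightSet_subset a b)) hu hvw
  have h2 := subset_tightSet_of_dotProduct_le (add_mem_poly ha hb) huK h1
  refine ⟨a, ha, fun i hi => ?_⟩
  have h3 : (a + b) ⬝ᵥ g i = -(x + y) i := h2 hi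
  have h4 := ha i
  have h5 := hb i
  rw [add_dotProduct, Pi.add_apply] at h3
  change a ⬝ᵥ g i = -x i
  linarith

/-! ### Faces and generators of chambers. -/

theorem chamber_isFaceOf {D E : ι → ℝ} (hD : (poly g D).Nonempty) (hE : E ∈ chamber g D) :
    (chamber g E).IsFaceOf (chamber g D) :=
  .of_mem_of_add_mem_left (chamber_le_chamber hE) fun hx hy hxy K hK =>
    (hxy K hK).of_add hD hx hy

theorem chamber_inf_isFaceOf {D E : ι → ℝ} (hD : (poly g D).Nonempty) :
    (chamber g D ⊓ chamber g E).IsFaceOf (chamber g D) :=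
  .of_mem_of_add_mem_left inf_le_left fun hx hy hxy =>
    ⟨hx, fun K hK => (hxy.2 K hK).of_add hD hx hy⟩

/-- Opposite elements of a chamber are linear. -/
theorem eq_linear_of_neg_mem_chamber {D x : ι → ℝ} (hD : (poly g D).Nonempty)
    (hx : x ∈ chamber g D) (hx' : -x ∈ chamber g D) : ∃ u : Fin n → ℝ, ∀ i, x i = u ⬝ᵥ g i := by
  have h : IsFaceSet g (x + -x) Set.univ := by rw [add_neg_cancel]; exact isFaceSet_zero _
  obtain ⟨u, -, hu⟩ := h.of_add hD hx hx'
  refine ⟨-u, fun i => ?_⟩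
  have : u ⬝ᵥ g i = -x i := hu (Set.mem_univ i)
  rw [neg_dotProduct, this, neg_neg]

/-- An element of a subcone of a chamber with the fewest face sets. -/
theorem exists_mem_le_chamber {D : ι → ℝ} (hD : (poly g D).Nonempty) (P : Set (ι → ℝ))
    (hP : P ⊆ chamber g D) (hne : P.Nonempty) (hadd : ∀ x ∈ P, ∀ y ∈ P, x + y ∈ P) :
    ∃ E ∈ P, P ⊆ chamber g E := by
  obtain ⟨F, hF⟩ := (Set.toFinite ((fun E => {K | IsFaceSet g E K}) '' P)).exists_minimal
    (hne.image _)
  obtain ⟨E, hE, rfl⟩ := hF.prop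
  refine ⟨E, hE, fun x hx K hK => ?_⟩
  -- The face sets of E + x are face sets of both E and x, and by minimality they are all those of
  -- E.
  have hle : {K | IsFaceSet g (E + x) K} ⊆ {K | IsFaceSet g E K} := fun K hK =>
    hK.of_add hD (hP hE) (hP hx)
  have h2 : IsFaceSet g (E + x) K := hF.le_of_le ⟨E + x, hadd E hE x hx, rfl⟩ hle hK
  rw [add_comm] at h2
  exact h2.of_add hD (hP hx) (hP hE)

/-- E is an element of G with the fewest face sets. Any x in `chamber g E` is linear on the face
sets of E, hence so is −x, and E − εx stays in the chamber for some ε > 0. Then E = εx + (E − εx)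
lies in the face G, which forces x into G. -/
theorem exists_eq_chamber_of_isFaceOf {D : ι → ℝ} (hD : (poly g D).Nonempty)
    {G : PointedCone ℝ (ι → ℝ)} (hG : G.IsFaceOf (chamber g D)) :
    ∃ E ∈ chamber g D, G = chamber g E := by
  obtain ⟨E, hE, hGE⟩ := exists_mem_le_chamber hD G hG.le ⟨0, G.zero_mem⟩
    fun x hx y hy => add_mem hx hy
  refine ⟨E, hG.le hE, le_antisymm hGE fun x hx => ?_⟩
  obtain ⟨ε, hε, h⟩ := exists_pos_of_eventually
    (eventually_add_smul_mem_chamber (g := g) (D := E) (E := -x) fun K hK => by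
      obtain ⟨u, -, huK⟩ := hx K hK
      refine ⟨-u, fun i hi => ?_⟩
      have : u ⬝ᵥ g i = -x i := huK hi
      rw [neg_dotProduct, this, Pi.neg_apply])
  refine hG.mem_of_smul_add_mem (chamber_le_chamber (hG.le hE) hx)
    (chamber_le_chamber (hG.le hE) h) hε ?_
  simpa using hE

/-- The existential in `IsFaceSet` becomes linear once a point u_K is an extra unknown for each K.
The chamber is the projection of the resulting integral cone, and integral generators upstairs carry
integral points u_K. -/
theorem exists_hull_eq_chamber (hg : ∀ i, g i ∈ integralVectors (Fin n)) (D : ι → ℝ) :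
    ∃ S : Finset (ι → ℝ), PointedCone.hull ℝ (S : Set (ι → ℝ)) = chamber g D ∧
      ∀ E ∈ S, E ∈ integralVectors ι ∧ ∀ K, IsFaceSet g D K →
        ∃ u ∈ integralVectors (Fin n), u ∈ poly g E ∧ K ⊆ tightSet g E u := by
  classical
  let φ : (ι ⊕ (Set ι × Fin n) → ℝ) →ₗ[ℝ] (ι → ℝ) := LinearMap.funLeft ℝ ℝ Sum.inl
  let τ : Set ι → (ι ⊕ (Set ι × Fin n) → ℝ) →ₗ[ℝ] (Fin n → ℝ) :=
    fun K => LinearMap.funLeft ℝ ℝ fun j => Sum.inr (K, j)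
  let l : Set ι × ι × Bool → (ι ⊕ (Set ι × Fin n) → ℝ) →ₗ[ℝ] ℝ := fun p =>
    (if p.2.2 then (-1 : ℝ) else 1) •
      (LinearMap.proj p.2.1 ∘ₗ φ + pairing (g p.2.1) ∘ₗ τ p.1)
  have hl : ∀ p y, l p y = (if p.2.2 then (-1 : ℝ) else 1) *
      (φ y p.2.1 + τ p.1 y ⬝ᵥ g p.2.1) := fun p y => rfl
  -- For a face set K of D, flag `false` imposes E_i + ⟨u_K, g i⟩ ≥ 0 for every i, and flag `true`
  -- the reverse inequality for i in K.
  let s : Finset (Set ι × ι × Bool) :=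
    Finset.univ.filter fun p => IsFaceSet g D p.1 ∧ (p.2.2 = true → p.2.1 ∈ p.1)
  have hint : ∀ p, ∀ y ∈ integralVectors (ι ⊕ (Set ι × Fin n)), ∃ k : ℤ, (k : ℝ) = l p y := by
    intro p y hy
    obtain ⟨a, ha⟩ := hy (Sum.inl p.2.1)
    choose b hb using fun j => hy (Sum.inr (p.1, j))
    choose c hc using hg p.2.1
    refine ⟨(if p.2.2 then (-1 : ℤ) else 1) * (a + ∑ j, b j * c j), ?_⟩
    rw [hl]
    have h1 : φ y p.2.1 = a := ha.symm
    have h2 : τ p.1 y ⬝ᵥ g p.2.1 = ∑ j, (b j : ℝ) * c j :=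
      Finset.sum_congr rfl fun j _ => by rw [hb, hc]; rfl
    rw [h1, h2]
    push_cast
    rfl
  obtain ⟨S₀, hS₀i, hS₀⟩ := exists_hull_eq_top (ι ⊕ (Set ι × Fin n))
  obtain ⟨S, hSi, hS⟩ := exists_hull_eq_halfSpaces _ S₀ hS₀i s l (by
    intro p _ x hx y hy i
    obtain ⟨k, hk⟩ := hint p x hx
    obtain ⟨m, hm⟩ := hy i
    exact ⟨k * m, by rw [Int.cast_mul, hk, hm]; rfl⟩)
  have hmem : ∀ y, y ∈ PointedCone.hull ℝ (S : Set (ι ⊕ (Set ι × Fin n) → ℝ)) ↔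
      ∀ K, IsFaceSet g D K → τ K y ∈ poly g (φ y) ∧ K ⊆ tightSet g (φ y) (τ K y) := by
    intro y
    rw [hS]
    constructor
    · rintro ⟨-, h⟩ K hK
      have h1 : ∀ i, 0 ≤ φ y i + τ K y ⬝ᵥ g i := by
        intro i
        have := h (K, i, false) (by simp [s, hK])
        simpa [hl] using this
      refine ⟨fun i => by have := h1 i; linarith, fun i hi => ?_⟩
      have := h (K, i, true) (by simp [s, hK, hi])
      rw [hl] at this
      have h2 := h1 i
      simp only [if_true] at this
      change τ K y ⬝ᵥ g i = -φ y i
      linarith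
    · intro h
      refine ⟨hS₀ y, ?_⟩
      rintro ⟨K, i, b⟩ hp
      simp only [s, Finset.mem_filter, Finset.mem_univ, true_and] at hp
      obtain ⟨h1, h2⟩ := h K hp.1
      rw [hl]
      cases b with
      | false =>
        have := h1 i
        simp only [Bool.false_eq_true, if_false]
        linarith
      | true =>
        have : τ K y ⬝ᵥ g i = -φ y i := h2 (hp.2 rfl)
        simp only [if_true]
        linarith
  have hspan : PointedCone.hull ℝ ((S.image φ : Finset (ι → ℝ)) : Set (ι → ℝ)) =
      PointedCone.map φ (PointedCone.hull ℝ (S : Set (ι ⊕ (Set ι × Fin n) → ℝ))) := by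
    rw [Finset.coe_image, map_hull]
  refine ⟨S.image φ, ?_, ?_⟩
  · rw [hspan]
    ext E
    rw [PointedCone.mem_map]
    constructor
    · rintro ⟨y, hy, rfl⟩ K hK
      exact ⟨τ K y, ((hmem y).1 hy K hK)⟩
    · intro hE
      have : ∀ K, ∃ u, IsFaceSet g D K → u ∈ poly g E ∧ K ⊆ tightSet g E u := by
        intro K
        by_cases hK : IsFaceSet g D K
        · obtain ⟨u, hu⟩ := hE K hK
          exact ⟨u, fun _ => hu⟩
        · exact ⟨0, fun h => absurd h hK⟩
      choose u hu using this
      exact ⟨Sum.elim E fun p => u p.1 p.2, (hmem _).2 hu, rfl⟩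
  · intro E hE
    obtain ⟨y, hy, rfl⟩ := Finset.mem_image.1 hE
    exact ⟨fun i => hSi hy _, fun K hK =>
      ⟨τ K y, fun j => hSi hy _, (hmem y).1 (Submodule.subset_span hy) K hK⟩⟩

/-- Each chamber is the chamber of an integral `E`, whose faces contain integral points. -/
theorem exists_integral_chamber_eq (hg : ∀ i, g i ∈ integralVectors (Fin n)) {D : ι → ℝ}
    (hD : (poly g D).Nonempty) :
    ∃ E ∈ chamber g D, D ∈ chamber g E ∧ ∀ K, IsFaceSet g D K →
        ∃ u ∈ integralVectors (Fin n), u ∈ poly g E ∧ K ⊆ tightSet g E u := by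
  obtain ⟨S, hS, hSi⟩ := exists_hull_eq_chamber hg D
  obtain ⟨E, ⟨hE, hEi⟩, hE'⟩ := exists_mem_le_chamber hD
    {E | E ∈ chamber g D ∧ ∀ K, IsFaceSet g D K →
        ∃ u ∈ integralVectors (Fin n), u ∈ poly g E ∧ K ⊆ tightSet g E u}
    (fun E hE => hE.1)
    ⟨0, Submodule.zero_mem _, fun K _ => ⟨0, zero_mem _, fun i => by simp, fun i _ => by
      simp [tightSet]⟩⟩
    (by
      rintro x ⟨hx, hxi⟩ y ⟨hy, hyi⟩
      refine ⟨add_mem hx hy, fun K hK => ?_⟩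
      obtain ⟨a, ha, haP, haK⟩ := hxi K hK
      obtain ⟨b, hb, hbP, hbK⟩ := hyi K hK
      exact ⟨a + b, add_mem ha hb, add_mem_poly haP hbP,
        (Set.subset_inter haK hbK).trans (inter_tightSet_subset a b)⟩)
  refine ⟨E, hE, ?_, hEi⟩
  have hle : PointedCone.hull ℝ (S : Set (ι → ℝ)) ≤ chamber g E :=
    Submodule.span_le.2 fun x hx => hE' ⟨hS ▸ Submodule.subset_span hx, (hSi x hx).2⟩
  exact hle (hS ▸ self_mem_chamber D)

end Configuration

end GKZ

namespace GKZ

/-! ### Rays -/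

section Rays

variable {n : ℕ}

theorem toReal_mem_integralVectors (v : Fin n → ℤ) : toReal v ∈ integralVectors (Fin n) :=
  fun i => ⟨v i, rfl⟩

theorem toReal_smul (k : ℤ) (v : Fin n → ℤ) : toReal (k • v) = (k : ℝ) • toReal v := by
  ext i
  simp [toReal]

/-- Here k is the gcd of the coordinates, as nonnegative generator of their ideal. -/
theorem exists_span_eq_and_smul (v : Fin n → ℤ) : ∃ (k : ℤ) (w : Fin n → ℤ),
    0 ≤ k ∧ v = k • w ∧ Ideal.span (Set.range v) = Ideal.span {k} := by
  obtain ⟨g, hg⟩ := (IsPrincipalIdealRing.principal (Ideal.span (Set.range v))).principal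
  have hg' : Ideal.span (Set.range v) = Ideal.span {|g|} := by
    rw [hg]
    exact (Ideal.span_singleton_eq_span_singleton.2 (Int.associated_iff_natAbs.2 g.natAbs_abs.symm))
  have hdvd : ∀ i, |g| ∣ v i := fun i => by
    rw [← Ideal.mem_span_singleton, ← hg']
    exact Ideal.subset_span ⟨i, rfl⟩
  choose w hw using hdvd
  exact ⟨|g|, w, abs_nonneg g, funext fun i => by simp [hw i], hg'⟩

theorem IsPrimitive.exists_sum_eq_one {v : Fin n → ℤ} (hv : IsPrimitive v) :
    ∃ a : Fin n → ℤ, ∑ i, a i * v i = 1 := by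
  obtain ⟨k, w, -, hvw, hspan⟩ := exists_span_eq_and_smul v
  have h1 : (1 : ℤ) ∈ Ideal.span (Set.range v) := by
    rw [hspan, Ideal.span_singleton_eq_top.2 (hv k w hvw)]
    trivial
  obtain ⟨a, ha⟩ := Ideal.mem_span_range_iff_exists_fun.1 h1
  exact ⟨a, ha⟩

theorem exists_isPrimitive_smul {v : Fin n → ℤ} (hv : v ≠ 0) :
    ∃ (k : ℤ) (w : Fin n → ℤ), 0 < k ∧ v = k • w ∧ IsPrimitive w := by
  obtain ⟨k, w, hk, hvw, hspan⟩ := exists_span_eq_and_smul v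
  have hk0 : k ≠ 0 := by
    rintro rfl
    exact hv (by rw [hvw, zero_smul])
  refine ⟨k, w, lt_of_le_of_ne hk hk0.symm, hvw, fun m z hwz => ?_⟩
  have h1 : Ideal.span (Set.range v) ≤ Ideal.span {k * m} := by
    rw [Ideal.span_le]
    rintro _ ⟨i, rfl⟩
    rw [SetLike.mem_coe, Ideal.mem_span_singleton, hvw, hwz]
    exact ⟨z i, by simp [mul_assoc]⟩
  rw [hspan, Ideal.span_singleton_le_span_singleton] at h1
  exact isUnit_of_dvd_one ((mul_dvd_mul_iff_left hk0).1 (by simpa using h1))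

theorem mem_hull_singleton {V : Type*} [AddCommGroup V] [Module ℝ V] {x y : V} :
    x ∈ PointedCone.hull ℝ {y} ↔ ∃ c : ℝ, 0 ≤ c ∧ x = c • y := by
  rw [PointedCone.hull, Submodule.mem_span_singleton]
  exact ⟨fun ⟨c, hc⟩ => ⟨c, c.2, hc.symm⟩, fun ⟨c, hc, h⟩ => ⟨⟨c, hc⟩, h.symm⟩⟩

/-- Write v = cw and w = dv with c, d ≥ 0. Bézout coefficients of v and w give integers k, m with ck
= dm = 1. Since cd = 1 also km = 1, and c ≥ 0 leaves k = 1, so c = 1. -/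
theorem IsPrimitive.eq_of_hull_eq {v w : Fin n → ℤ} (hv : IsPrimitive v) (hw : IsPrimitive w)
    (h : PointedCone.hull ℝ {toReal v} = PointedCone.hull ℝ {toReal w}) : v = w := by
  obtain ⟨c, hc, hvw⟩ := mem_hull_singleton.1
    (h ▸ Submodule.subset_span rfl : toReal v ∈ PointedCone.hull ℝ {toReal w})
  obtain ⟨d, hd, hwv⟩ := mem_hull_singleton.1
    (h ▸ Submodule.subset_span rfl : toReal w ∈ PointedCone.hull ℝ {toReal v})
  obtain ⟨a, ha⟩ := hv.exists_sum_eq_one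
  obtain ⟨b, hb⟩ := hw.exists_sum_eq_one
  have hvi : ∀ i, (v i : ℝ) = c * w i := fun i => congrFun hvw i
  have hwi : ∀ i, (w i : ℝ) = d * v i := fun i => congrFun hwv i
  have h1 : c * ((∑ i, a i * w i : ℤ) : ℝ) = 1 := by
    have : ((∑ i, a i * v i : ℤ) : ℝ) = 1 := by exact_mod_cast ha
    rw [← this]
    push_cast
    rw [Finset.mul_sum]
    exact Finset.sum_congr rfl fun i _ => by rw [hvi]; ring
  have h2 : d * ((∑ i, b i * v i : ℤ) : ℝ) = 1 := by
    have : ((∑ i, b i * w i : ℤ) : ℝ) = 1 := by exact_mod_cast hb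
    rw [← this]
    push_cast
    rw [Finset.mul_sum]
    exact Finset.sum_congr rfl fun i _ => by rw [hwi]; ring
  have h3 : c * d = 1 := by
    have : ((∑ i, a i * v i : ℤ) : ℝ) = 1 := by exact_mod_cast ha
    calc c * d = c * d * ((∑ i, a i * v i : ℤ) : ℝ) := by rw [this, mul_one]
      _ = c * ((∑ i, a i * w i : ℤ) : ℝ) := by
        push_cast
        rw [Finset.mul_sum, Finset.mul_sum]
        exact Finset.sum_congr rfl fun i _ => by rw [hwi]; ring
      _ = 1 := h1
  set k : ℤ := ∑ i, a i * w i
  set m : ℤ := ∑ i, b i * v i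
  have hkm : k * m = 1 := by
    have : ((k * m : ℤ) : ℝ) = 1 := by
      push_cast
      calc (k : ℝ) * m = (c * d) * (k * m) := by rw [h3, one_mul]
        _ = (c * k) * (d * m) := by ring
        _ = 1 := by rw [h1, h2, one_mul]
    exact_mod_cast this
  have hk1 : k = 1 := by
    rcases Int.eq_one_or_neg_one_of_mul_eq_one hkm with h | h
    · exact h
    · rw [h] at h1
      push_cast at h1
      linarith
  rw [hk1] at h1
  ext i
  have := hvi i
  rw [show c = 1 by simpa using h1, one_mul] at this
  exact_mod_cast this

variable {Δ : Set (PointedCone ℝ (Fin n → ℝ))}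

theorem finite_ray (hΔ : Δ.Finite) : Finite (Ray Δ) := by
  have := hΔ.to_subtype
  refine Finite.of_injective
    (fun ρ : Ray Δ => (⟨PointedCone.hull ℝ {toReal ρ.1}, ρ.2.2⟩ : Δ)) fun ρ τ h => ?_
  exact Subtype.ext (ρ.2.1.eq_of_hull_eq τ.2.1 (Subtype.ext_iff.1 h))

/-- An irredundant generator of a strongly convex cone generates a face. -/
theorem hull_singleton_isFaceOf {V : Type*} [AddCommGroup V] [Module ℝ V] {T : Set V} {s : V}
    {σ : PointedCone ℝ V} (hσ : σ = PointedCone.hull ℝ (insert s T))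
    (hsc : ∀ x ∈ σ, -x ∈ σ → x = 0) (hs : s ∉ PointedCone.hull ℝ T) :
    (PointedCone.hull ℝ {s}).IsFaceOf σ := by
  have hdec : ∀ x ∈ σ, ∃ a : ℝ, 0 ≤ a ∧ ∃ p ∈ PointedCone.hull ℝ T, x = a • s + p := by
    intro x hx
    rw [hσ, PointedCone.hull, Submodule.mem_span_insert] at hx
    obtain ⟨a, p, hp, rfl⟩ := hx
    exact ⟨a, a.2, p, hp, rfl⟩
  have hTσ : PointedCone.hull ℝ T ≤ σ := hσ ▸ Submodule.span_mono (Set.subset_insert _ _)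
  have hsσ : s ∈ σ := hσ ▸ Submodule.subset_span (Set.mem_insert _ _)
  refine .of_mem_of_add_mem_left ?_ fun {x y} hx hy hxy => ?_
  · rw [PointedCone.hull, Submodule.span_le]
    exact Set.singleton_subset_iff.2 hsσ
  obtain ⟨a, ha, p, hp, rfl⟩ := hdec x hx
  obtain ⟨b, hb, q, hq, rfl⟩ := hdec y hy
  obtain ⟨t, ht, h⟩ := mem_hull_singleton.1 hxy
  have hpq : p + q = (t - a - b) • s := by
    have : p + q = t • s - a • s - b • s := by rw [← h]; abel
    rw [this, sub_smul, sub_smul]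
  -- A positive coefficient would put s in the hull of T. Otherwise −p lies in σ as well as p, and
  -- strong convexity gives p = 0.
  rcases lt_or_ge 0 (t - a - b) with h0 | h0
  · refine absurd ?_ hs
    have := smul_mem_cone _ (inv_nonneg.2 h0.le) (add_mem hp hq)
    rwa [hpq, inv_smul_smul₀ h0.ne'] at this
  · have hp0 : p = 0 := by
      refine hsc p (hTσ hp) ?_
      have : -p = q + (-(t - a - b)) • s := by rw [neg_smul, ← hpq]; abel
      rw [this]
      exact add_mem (hTσ hq) (smul_mem_cone _ (neg_nonneg.2 h0) hsσ)
    rw [hp0, add_zero]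
    exact mem_hull_singleton.2 ⟨a, ha, rfl⟩

theorem gen_mem_support (ρ : Ray Δ) : ρ.gen ∈ support Δ :=
  Set.mem_biUnion ρ.2.2 (Submodule.subset_span rfl)

/-- In a minimal finite set of lattice generators of σ each element is irredundant, so it generates
a face; that face belongs to Δ and is a ray. -/
theorem le_hull_range_gen (hΔ : IsFan (latticeN n) Δ) {σ : PointedCone ℝ (Fin n → ℝ)}
    (hσ : σ ∈ Δ) : σ ≤ PointedCone.hull ℝ (Set.range (Ray.gen (Δ := Δ))) := by
  classical
  obtain ⟨S, ⟨hS, hσS⟩, hmin⟩ := WellFounded.has_min (wellFounded_lt (α := Finset (Fin n → ℝ)))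
    {S | (S : Set (Fin n → ℝ)) ⊆ latticeN n ∧ σ = PointedCone.hull ℝ (S : Set (Fin n → ℝ))}
    (hΔ.rational σ hσ)
  conv_lhs => rw [hσS]
  rw [PointedCone.hull, Submodule.span_le]
  intro s hs
  have hins : (S : Set (Fin n → ℝ)) = insert s ((S.erase s : Finset _) : Set (Fin n → ℝ)) := by
    rw [← Finset.coe_insert, Finset.insert_erase hs]
  have hnot : s ∉ PointedCone.hull ℝ ((S.erase s : Finset _) : Set (Fin n → ℝ)) := by
    intro h
    refine hmin (S.erase s) ⟨fun x hx => hS (Finset.mem_of_mem_erase hx), ?_⟩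
      (Finset.erase_ssubset hs)
    rw [hσS, hins, PointedCone.hull]
    exact Submodule.span_insert_eq_span h
  have hface := hull_singleton_isFaceOf (hins ▸ hσS) (hΔ.stronglyConvex σ hσ) hnot
  obtain ⟨w, rfl⟩ := hS hs
  have hw : w ≠ 0 := by
    rintro rfl
    refine hnot ?_
    have : toReal (0 : Fin n → ℤ) = 0 := by ext; simp [toReal]
    rw [this]
    exact Submodule.zero_mem _
  obtain ⟨k, z, hk, rfl, hz⟩ := exists_isPrimitive_smul hw
  have hk' : (0 : ℝ) < k := by exact_mod_cast hk
  have hhull : PointedCone.hull ℝ {toReal (k • z)} = PointedCone.hull ℝ {toReal z} := by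
    ext x
    rw [mem_hull_singleton, mem_hull_singleton, toReal_smul]
    constructor
    · rintro ⟨c, hc, rfl⟩
      exact ⟨c * k, by positivity, by rw [mul_smul]⟩
    · rintro ⟨c, hc, rfl⟩
      refine ⟨c / k, by positivity, ?_⟩
      rw [smul_smul, div_mul_cancel₀ _ hk'.ne']
  let ρ : Ray Δ := ⟨z, hz, hhull ▸ hΔ.face_mem σ hσ _ hface⟩
  rw [toReal_smul]
  exact smul_mem_cone _ hk'.le (Submodule.subset_span ⟨ρ, rfl⟩)

/-- The rays generate the support, if it is convex. -/
theorem coe_hull_range_gen (hΔ : IsFan (latticeN n) Δ) (hconv : Convex ℝ (support Δ)) :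
    (PointedCone.hull ℝ (Set.range (Ray.gen (Δ := Δ))) : Set (Fin n → ℝ)) = support Δ := by
  have hsmul : ∀ c : ℝ, 0 ≤ c → ∀ x ∈ support Δ, c • x ∈ support Δ := by
    intro c hc x hx
    obtain ⟨σ, hσ, hx⟩ := Set.mem_iUnion₂.1 hx
    exact Set.mem_biUnion hσ (smul_mem_cone σ hc hx)
  refine subset_antisymm (fun x hx => ?_) fun x hx => ?_
  · induction hx using Submodule.span_induction with
    | mem x hx =>
      obtain ⟨ρ, rfl⟩ := hx
      exact gen_mem_support ρ
    | zero =>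
      obtain ⟨σ, hσ⟩ := hΔ.nonempty
      exact Set.mem_biUnion hσ σ.zero_mem
    | add x y _ _ hx hy =>
      have := hsmul 2 zero_le_two _
        (hconv hx hy (by norm_num : (0 : ℝ) ≤ 1 / 2) (by norm_num : (0 : ℝ) ≤ 1 / 2) (by norm_num))
      rw [← smul_add, smul_smul] at this
      simpa using this
    | smul a x _ hx => exact hsmul a a.2 x hx
  · obtain ⟨σ, hσ, hx⟩ := Set.mem_iUnion₂.1 hx
    exact le_hull_range_gen hΔ hσ hx

theorem eq_zero_of_forall_gen [Fintype (Ray Δ)]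
    (hsupp : (PointedCone.hull ℝ (Set.range (Ray.gen (Δ := Δ))) : Set (Fin n → ℝ)) = support Δ)
    (hdim : coneDim (support Δ) = n) {u : Fin n → ℝ} (hu : ∀ ρ : Ray Δ, u ⬝ᵥ ρ.gen = 0) :
    u = 0 := by
  have h1 : Submodule.span ℝ (support Δ) = ⊤ :=
    Submodule.eq_top_of_finrank_eq (by rw [Module.finrank_fin_fun]; exact hdim)
  have h2 : ∀ x ∈ Submodule.span ℝ (support Δ), u ⬝ᵥ x = 0 := by
    intro x hx
    induction hx using Submodule.span_induction with
    | mem x hx =>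
      rw [← hsupp, ← Set.image_univ] at hx
      rw [dotProduct_eq_of_mem_hull (w := 0) (fun ρ _ => by rw [hu, zero_dotProduct]) hx,
        zero_dotProduct]
    | zero => exact dotProduct_zero u
    | add x y _ _ hx hy => rw [dotProduct_add, hx, hy, add_zero]
    | smul a x _ hx => rw [dotProduct_smul, hx, smul_zero]
  exact dotProduct_self_eq_zero.1 (h2 u (h1 ▸ trivial))

end Rays

end GKZ

namespace GKZ

/-! ### The normal fan -/

section Configuration

variable {ι : Type*} {n : ℕ} {g : ι → Fin n → ℝ}

theorem convex_poly (D : ι → ℝ) : Convex ℝ (poly g D) := by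
  intro u hu w hw a b ha hb hab i
  have h1 := mul_le_mul_of_nonneg_left (hu i) ha
  have h2 := mul_le_mul_of_nonneg_left (hw i) hb
  have h3 : -D i = a * -D i + b * -D i := by rw [← add_mul, hab, one_mul]
  rw [add_dotProduct, smul_dotProduct, smul_dotProduct, smul_eq_mul, smul_eq_mul]
  linarith

theorem midpoint_mem {Q : Set (Fin n → ℝ)} (hQ : Convex ℝ Q) {u w : Fin n → ℝ} (hu : u ∈ Q)
    (hw : w ∈ Q) : (1 / 2 : ℝ) • u + (1 / 2 : ℝ) • w ∈ Q :=
  hQ hu hw (by norm_num) (by norm_num) (by norm_num)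

theorem tightSet_midpoint {D : ι → ℝ} {u w : Fin n → ℝ} (hu : u ∈ poly g D) (hw : w ∈ poly g D) :
    tightSet g D ((1 / 2 : ℝ) • u + (1 / 2 : ℝ) • w) = tightSet g D u ∩ tightSet g D w := by
  ext i
  have h1 := hu i
  have h2 := hw i
  simp only [tightSet, Set.mem_inter_iff, Set.mem_ofPred_eq, add_dotProduct, smul_dotProduct,
    smul_eq_mul]
  constructor
  · intro h
    constructor <;> linarith
  · rintro ⟨h3, h4⟩
    linarith

/-- A convex set of points of a polyhedron contains one with the fewest tight inequalities. -/
theorem exists_tightSet_subset [Finite ι] {D : ι → ℝ} {Q : Set (Fin n → ℝ)} (hQ : Convex ℝ Q)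
    (hne : Q.Nonempty) (hQD : Q ⊆ poly g D) :
    ∃ q ∈ Q, ∀ w ∈ Q, tightSet g D q ⊆ tightSet g D w := by
  obtain ⟨F, hF⟩ := (Set.toFinite (tightSet g D '' Q)).exists_minimal (hne.image _)
  obtain ⟨q, hq, rfl⟩ := hF.prop
  refine ⟨q, hq, fun w hw => ?_⟩
  have hmid := tightSet_midpoint (hQD hq) (hQD hw)
  have hle : tightSet g D ((1 / 2 : ℝ) • q + (1 / 2 : ℝ) • w) ⊆ tightSet g D q :=
    hmid ▸ Set.inter_subset_left
  have h2 := hF.le_of_le ⟨_, midpoint_mem hQ hq hw, rfl⟩ hle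
  exact h2.trans (hmid ▸ Set.inter_subset_right)

variable [Fintype ι]

theorem normalConeAt_inf_isFaceOf {D : ι → ℝ} {u w : Fin n → ℝ} (hu : u ∈ poly g D)
    (hw : w ∈ poly g D) :
    (normalConeAt g D u ⊓ normalConeAt g D w).IsFaceOf (normalConeAt g D u) := by
  refine .of_mem_of_add_mem_left inf_le_left fun {x y} hx hy hxy => ⟨hx, ?_⟩
  have hx' := (mem_normalConeAt_iff hu).1 hx
  have hy' := (mem_normalConeAt_iff hu).1 hy
  have h1 := ((mem_normalConeAt_iff hw).1 hxy.2).2 u hu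
  have h2 := hy'.2 w hw
  rw [dotProduct_add, dotProduct_add] at h1
  exact (mem_normalConeAt_iff hw).2 ⟨hx'.1, fun a ha => by have := hx'.2 a ha; linarith⟩

/-- The midpoint of u and w also minimizes x, and its tight set is the intersection. Linear
functions that agree on common tight generators therefore agree on the overlap of the normal cones.
-/
theorem mem_normalConeAt_inter {D : ι → ℝ} {u w x : Fin n → ℝ} (hu : u ∈ poly g D)
    (hw : w ∈ poly g D) (hxu : x ∈ normalConeAt g D u) (hxw : x ∈ normalConeAt g D w) :
    x ∈ PointedCone.hull ℝ (g '' (tightSet g D u ∩ tightSet g D w)) := by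
  rw [← tightSet_midpoint hu hw]
  refine (mem_normalConeAt_iff (midpoint_mem (convex_poly D) hu hw)).2
    ⟨((mem_normalConeAt_iff hu).1 hxu).1, fun a ha => ?_⟩
  have h1 := ((mem_normalConeAt_iff hu).1 hxu).2 a ha
  have h2 := ((mem_normalConeAt_iff hw).1 hxw).2 a ha
  rw [add_dotProduct, smul_dotProduct, smul_dotProduct, smul_eq_mul, smul_eq_mul]
  linarith

theorem gen_mem_of_mem_isFaceOf {K : Set ι} {τ : PointedCone ℝ (Fin n → ℝ)}
    (hτ : τ.IsFaceOf (PointedCone.hull ℝ (g '' K))) {c : ι → ℝ} (hc : ∀ i, 0 ≤ c i)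
    (hcK : ∀ i ∉ K, c i = 0) (h : ∑ i, c i • g i ∈ τ) {i : ι} (hi : c i ≠ 0) : g i ∈ τ := by
  have hmem : ∀ j, c j • g j ∈ PointedCone.hull ℝ (g '' K) := by
    intro j
    by_cases hj : j ∈ K
    · exact smul_mem_cone _ (hc j) (Submodule.subset_span ⟨j, hj, rfl⟩)
    · rw [hcK j hj, zero_smul]
      exact Submodule.zero_mem _
  have h1 := smul_mem_cone _ (inv_nonneg.2 (hc i)) (hτ.mem_of_sum_mem hmem h i)
  rwa [inv_smul_smul₀ hi] at h1

/-- A face of a finitely generated cone is generated by the generators in it. -/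
theorem eq_hull_image_of_isFaceOf {K : Set ι} {τ : PointedCone ℝ (Fin n → ℝ)}
    (hτ : τ.IsFaceOf (PointedCone.hull ℝ (g '' K))) :
    τ = PointedCone.hull ℝ (g '' {i ∈ K | g i ∈ τ}) := by
  refine le_antisymm (fun x hx => ?_) ?_
  · obtain ⟨c, hc, hcK, rfl⟩ := mem_hull_image.1 (hτ.le hx)
    refine mem_hull_image.2 ⟨c, hc, fun i hi => ?_, rfl⟩
    by_contra hcon
    refine hi ⟨?_, gen_mem_of_mem_isFaceOf hτ hc hcK hx hcon⟩
    by_contra hiK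
    exact hcon (hcK i hiK)
  · rw [PointedCone.hull, Submodule.span_le]
    rintro _ ⟨i, hi, rfl⟩
    exact hi.2

/-- A face of a finitely generated cone has a supporting hyperplane that avoids a given generator
outside it. -/
theorem exists_supporting_of_isFaceOf {K : Set ι} {τ : PointedCone ℝ (Fin n → ℝ)}
    (hτ : τ.IsFaceOf (PointedCone.hull ℝ (g '' K))) {j : ι} (hj : j ∈ K) (hjτ : g j ∉ τ) :
    ∃ a : Fin n → ℝ, (∀ i ∈ K, 0 ≤ a ⬝ᵥ g i) ∧ (∀ i ∈ K, g i ∈ τ → a ⬝ᵥ g i = 0) ∧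
      0 < a ⬝ᵥ g j := by
  classical
  -- Let v be the sum of the generators in τ. A functional nonnegative on K and on −v vanishes on
  -- those generators, hence is nonpositive at g j by assumption. Farkas then puts −g j in the cone
  -- of K and −v, so g j + p is a multiple of v in τ, and g j lies in τ.
  by_contra! hcon
  set v := ∑ i, (if i ∈ {i ∈ K | g i ∈ τ} then (1 : ℝ) else 0) • g i with hv
  have hvτ : v ∈ τ := by
    have := sum_ite_mem_hull (g := g) {i ∈ K | g i ∈ τ}
    rwa [← eq_hull_image_of_isFaceOf hτ] at this
  let g' : Option ι → Fin n → ℝ := fun o => o.elim (-v) g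
  have hmem : -g j ∈ PointedCone.hull ℝ (g' '' {o | ∀ i, o = some i → i ∈ K}) := by
    refine mem_hull_image_of_forall fun a ha => ?_
    have h1 : ∀ i ∈ K, 0 ≤ a ⬝ᵥ g i := fun i hi => ha (some i) (by rintro _ ⟨rfl⟩; exact hi)
    have h2 : 0 ≤ a ⬝ᵥ (-v) := ha none (by simp)
    rw [dotProduct_neg, neg_nonneg, hv, dotProduct_sum_smul] at h2
    have h3 : ∀ i ∈ K, g i ∈ τ → a ⬝ᵥ g i = 0 := by
      intro i hi hiτ
      have hnn : ∀ i ∈ Finset.univ,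
          0 ≤ (if i ∈ {i ∈ K | g i ∈ τ} then (1 : ℝ) else 0) * (a ⬝ᵥ g i) := by
        intro i _
        split_ifs with h
        · rw [one_mul]; exact h1 i h.1
        · rw [zero_mul]
      have := (Finset.sum_eq_zero_iff_of_nonneg hnn).1
        (le_antisymm h2 (Finset.sum_nonneg hnn)) i (Finset.mem_univ i)
      rwa [if_pos ⟨hi, hiτ⟩, one_mul] at this
    rw [dotProduct_neg, neg_nonneg]
    exact hcon a h1 h3
  obtain ⟨c, hc, hcK, hsum⟩ := mem_hull_image.1 hmem
  rw [Fintype.sum_option] at hsum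
  set p := ∑ i, c (some i) • g' (some i) with hp
  have hpK : p ∈ PointedCone.hull ℝ (g '' K) :=
    mem_hull_image.2 ⟨fun i => c (some i), fun i => hc _,
      fun i hi => hcK _ (fun h => hi (h i rfl)), rfl⟩
  have heq : g j + p = c none • v := by
    have : g' none = -v := rfl
    rw [this, smul_neg] at hsum
    have h4 : g j = c none • v - p := by rw [← neg_neg (g j), hsum]; abel
    rw [h4]; abel
  exact hjτ (hτ.mem_of_add_mem_left (Submodule.subset_span ⟨j, hj, rfl⟩) hpK
    (heq ▸ smul_mem_cone _ (hc none) hvτ))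

/-- Among the points tight on the generators in τ, take w with the fewest tight inequalities. An
extra one at j would also be tight at u, and moving u slightly along a supporting functional
positive at g j would remove it. -/
theorem exists_normalConeAt_eq_of_isFaceOf {D : ι → ℝ} {u : Fin n → ℝ} (hu : u ∈ poly g D)
    {τ : PointedCone ℝ (Fin n → ℝ)} (hτ : τ.IsFaceOf (normalConeAt g D u)) :
    ∃ w ∈ poly g D, τ = normalConeAt g D w := by
  set K : Set ι := {i ∈ tightSet g D u | g i ∈ τ} with hK
  have hQ : Convex ℝ {w ∈ poly g D | K ⊆ tightSet g D w} := by
    intro a ha b hb s t hs ht hst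
    refine ⟨convex_poly D ha.1 hb.1 hs ht hst, fun i hi => ?_⟩
    have h1 : a ⬝ᵥ g i = -D i := ha.2 hi
    have h2 : b ⬝ᵥ g i = -D i := hb.2 hi
    have h3 : -D i = s * -D i + t * -D i := by rw [← add_mul, hst, one_mul]
    change (s • a + t • b) ⬝ᵥ g i = -D i
    rw [add_dotProduct, smul_dotProduct, smul_dotProduct, smul_eq_mul, smul_eq_mul, h1, h2, ← h3]
  have huQ : u ∈ {w ∈ poly g D | K ⊆ tightSet g D w} := ⟨hu, fun i hi => hi.1⟩
  obtain ⟨w, hw, hmin⟩ := exists_tightSet_subset hQ ⟨u, huQ⟩ fun w hw => hw.1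
  refine ⟨w, hw.1, ?_⟩
  have hwK : tightSet g D w = K := by
    refine subset_antisymm (fun j hj => ?_) hw.2
    have hju := hmin u huQ hj
    refine ⟨hju, ?_⟩
    by_contra hjτ
    obtain ⟨a, ha, haτ, haj⟩ := exists_supporting_of_isFaceOf hτ hju hjτ
    obtain ⟨ε, hε, h⟩ := exists_pos_of_eventually
      (eventually_add_mul_pos (fun i => u ⬝ᵥ g i + D i) (fun i => a ⬝ᵥ g i))
    have hmem : u + ε • a ∈ {w ∈ poly g D | K ⊆ tightSet g D w} := by
      refine ⟨fun i => ?_, fun i hi => ?_⟩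
      · rw [add_dotProduct, smul_dotProduct, smul_eq_mul]
        by_cases hi : i ∈ tightSet g D u
        · have h1 : u ⬝ᵥ g i = -D i := hi
          have := mul_nonneg hε.le (ha i hi)
          linarith
        · have := h i (by
            have := lt_of_le_of_ne (hu i) (Ne.symm hi)
            linarith)
          linarith
      · have h1 : u ⬝ᵥ g i = -D i := hi.1
        change (u + ε • a) ⬝ᵥ g i = -D i
        rw [add_dotProduct, smul_dotProduct, haτ i hi.1 hi.2, h1, smul_zero, add_zero]
    have h1 : u ⬝ᵥ g j = -D j := hju
    have h2 : (u + ε • a) ⬝ᵥ g j = -D j := hmin _ hmem hj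
    rw [add_dotProduct, smul_dotProduct, smul_eq_mul, h1] at h2
    have := mul_pos hε haj
    linarith
  rw [normalConeAt, hwK]
  exact eq_hull_image_of_isFaceOf hτ

end Configuration

section NormalFan

variable {n : ℕ} {Δ : Set (PointedCone ℝ (Fin n → ℝ))} [Fintype (Ray Δ)]
  (hsupp : (PointedCone.hull ℝ (Set.range (Ray.gen (Δ := Δ))) : Set (Fin n → ℝ)) = support Δ)

include hsupp

/-- A face Q has the same normal cone as a point of Q with the fewest tight inequalities, so points
can replace faces as indices. -/
theorem mem_normalFan_iff {D : WeilDivisor Δ} {σ : PointedCone ℝ (Fin n → ℝ)} :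
    σ ∈ normalFan D ↔ ∃ u ∈ poly Ray.gen D, σ = normalConeAt Ray.gen D u := by
  classical
  constructor
  · rintro ⟨Q, hne, hQ, hσ⟩
    have hQsub : Q ⊆ poly Ray.gen D := hQ.subset
    obtain ⟨q, hq, hmin⟩ := exists_tightSet_subset (hQ.convex (convex_poly D)) hne hQsub
    refine ⟨q, hQsub hq, SetLike.coe_injective ?_⟩
    rw [hσ]
    ext v
    rw [SetLike.mem_coe, mem_normalConeAt_iff (hQsub hq)]
    constructor
    · rintro ⟨hv, h⟩
      exact ⟨by rwa [← SetLike.mem_coe, hsupp], fun w hw => h w hw q hq⟩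
    · intro h
      refine ⟨hsupp ▸ h.1, fun u hu w hw => ?_⟩
      exact dotProduct_le_of_mem_hull (hmin w hw) hu ((mem_normalConeAt_iff (hQsub hq)).2 h)
  · rintro ⟨u, hu, rfl⟩
    set K := tightSet Ray.gen D u with hK
    have hv := sum_ite_mem_hull (g := Ray.gen (Δ := Δ)) K
    set v := ∑ ρ, (if ρ ∈ K then (1 : ℝ) else 0) • Ray.gen ρ with hvdef
    have huv : ∀ w ∈ poly Ray.gen D, u ⬝ᵥ v ≤ w ⬝ᵥ v := fun w hw =>
      dotProduct_le_of_mem_hull subset_rfl hw hv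
    have hQ : ∀ w ∈ poly Ray.gen D, w ⬝ᵥ v ≤ u ⬝ᵥ v ↔ K ⊆ tightSet Ray.gen D w := fun w hw =>
      ⟨fun h => subset_tightSet_of_dotProduct_le hw subset_rfl h,
        fun h => dotProduct_le_of_mem_hull h hu hv⟩
    refine ⟨{w ∈ poly Ray.gen D | K ⊆ tightSet Ray.gen D w}, ⟨u, hu, subset_rfl⟩, fun _ => ?_, ?_⟩
    -- Exposed faces maximize a functional, while this face minimizes v; hence the sign.
    · refine ⟨LinearMap.toContinuousLinearMap (-pairing v), ?_⟩
      ext w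
      simp only [Set.mem_ofPred_eq, LinearMap.coe_toContinuousLinearMap', LinearMap.neg_apply,
        pairing_apply, neg_le_neg_iff]
      refine and_congr_right fun hw => ?_
      rw [← hQ w hw]
      exact ⟨fun h y hy => h.trans (huv y hy), fun h => h u hu⟩
    · ext x
      constructor
      · intro hx
        refine ⟨hsupp ▸ ((mem_normalConeAt_iff hu).1 hx).1, fun a ha w hw => ?_⟩
        exact dotProduct_le_of_mem_hull hw.2 ha hx
      · rintro ⟨hx, h⟩
        exact (mem_normalConeAt_iff hu).2
          ⟨by rwa [← SetLike.mem_coe, hsupp], fun a ha => h a ha u ⟨hu, subset_rfl⟩⟩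

theorem normalConeAt_mem_normalFan {D : WeilDivisor Δ} {u : Fin n → ℝ}
    (hu : u ∈ poly Ray.gen D) : normalConeAt Ray.gen D u ∈ normalFan D :=
  (mem_normalFan_iff hsupp).2 ⟨u, hu, rfl⟩

theorem support_normalFan {D : WeilDivisor Δ} (hD : (poly Ray.gen D).Nonempty) :
    support (normalFan D) = support Δ := by
  ext x
  rw [← hsupp]
  constructor
  · intro hx
    obtain ⟨σ, hσ, hx⟩ := Set.mem_iUnion₂.1 hx
    obtain ⟨u, hu, rfl⟩ := (mem_normalFan_iff hsupp).1 hσ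
    exact ((mem_normalConeAt_iff hu).1 hx).1
  · intro hx
    obtain ⟨u, hu, hxu⟩ := exists_mem_normalConeAt hD hx
    exact Set.mem_biUnion (normalConeAt_mem_normalFan hsupp hu) hxu

theorem isPossiblyDegenerateFan_normalFan {D : WeilDivisor Δ} (hD : (poly Ray.gen D).Nonempty) :
    IsPossiblyDegenerateFan (latticeN n) (normalFan D) where
  finite := by
    refine (Set.toFinite (Set.range fun K : Set (Ray Δ) =>
      PointedCone.hull ℝ (Ray.gen '' K))).subset fun σ hσ => ?_
    obtain ⟨u, -, rfl⟩ := (mem_normalFan_iff hsupp).1 hσ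
    exact ⟨_, rfl⟩
  nonempty := by
    obtain ⟨u, hu⟩ := hD
    exact ⟨_, normalConeAt_mem_normalFan hsupp hu⟩
  rational σ hσ := by
    obtain ⟨u, -, rfl⟩ := (mem_normalFan_iff hsupp).1 hσ
    have hfin := (Set.toFinite (Ray.gen '' tightSet Ray.gen D u))
    refine ⟨hfin.toFinset, ?_, by rw [hfin.coe_toFinset]; rfl⟩
    rw [hfin.coe_toFinset]
    rintro _ ⟨ρ, -, rfl⟩
    exact ⟨ρ.1, rfl⟩
  face_mem σ hσ τ hτ := by
    obtain ⟨u, hu, rfl⟩ := (mem_normalFan_iff hsupp).1 hσ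
    exact (mem_normalFan_iff hsupp).2 (exists_normalConeAt_eq_of_isFaceOf hu hτ)
  inter_left σ hσ τ hτ := by
    obtain ⟨u, hu, rfl⟩ := (mem_normalFan_iff hsupp).1 hσ
    obtain ⟨w, hw, rfl⟩ := (mem_normalFan_iff hsupp).1 hτ
    exact normalConeAt_inf_isFaceOf hu hw
  inter_right σ hσ τ hτ := by
    obtain ⟨u, hu, rfl⟩ := (mem_normalFan_iff hsupp).1 hσ
    obtain ⟨w, hw, rfl⟩ := (mem_normalFan_iff hsupp).1 hτ
    rw [inf_comm]
    exact normalConeAt_inf_isFaceOf hw hu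

omit hsupp [Fintype (Ray Δ)] in
theorem notMem_excessRays_iff {D : WeilDivisor Δ} {ρ : Ray Δ} :
    ρ ∉ excessRays D ↔ IsFaceSet Ray.gen D {ρ} := by
  change ¬¬_ ↔ _
  rw [not_not]
  constructor
  · rintro ⟨⟨u, hu, h⟩, -⟩
    exact ⟨u, hu, Set.singleton_subset_iff.2 h⟩
  · rintro ⟨u, hu, h⟩
    refine ⟨⟨u, hu, h rfl⟩, ?_⟩
    rintro _ ⟨w, hw, rfl⟩
    exact hw ρ

/-- The conditions that define a GKZ cone are those that define a chamber. -/
theorem refines_normalFan_iff {D E : WeilDivisor Δ} (hD : (poly Ray.gen D).Nonempty)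
    (hE : (poly Ray.gen E).Nonempty) :
    Refines (normalFan D) (normalFan E) ∧ excessRays E ⊆ excessRays D ↔
      E ∈ chamber Ray.gen D := by
  constructor
  · rintro ⟨⟨-, href⟩, hex⟩ K ⟨u, hu, huK⟩
    obtain ⟨τ, hτ, hle⟩ := href _ (normalConeAt_mem_normalFan hsupp hu)
    obtain ⟨w, hw, rfl⟩ := (mem_normalFan_iff hsupp).1 hτ
    refine ⟨w, hw, fun ρ hρ => ?_⟩
    have h1 : ρ ∉ excessRays D :=
      notMem_excessRays_iff.2 ⟨u, hu, Set.singleton_subset_iff.2 (huK hρ)⟩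
    obtain ⟨a, ha, haρ⟩ := notMem_excessRays_iff.1 fun h => h1 (hex h)
    -- Refinement makes w a minimizer of v_ρ, and the condition on excess rays makes that minimum
    -- equal to −E ρ. Together they give tightness at w.
    have h2 := ((mem_normalConeAt_iff hw).1 (hle (Submodule.subset_span ⟨ρ, huK hρ, rfl⟩))).2 a ha
    have h3 : a ⬝ᵥ ρ.gen = -E ρ := haρ rfl
    exact le_antisymm (h3 ▸ h2) (hw ρ)
  · intro h
    refine ⟨⟨by rw [support_normalFan hsupp hD, support_normalFan hsupp hE], fun σ hσ => ?_⟩,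
      fun ρ hρ => ?_⟩
    · obtain ⟨u, hu, rfl⟩ := (mem_normalFan_iff hsupp).1 hσ
      obtain ⟨w, hw, huw⟩ := h _ (isFaceSet_tightSet hu)
      exact ⟨_, normalConeAt_mem_normalFan hsupp hw, Submodule.span_mono (Set.image_mono huw)⟩
    · by_contra hcon
      exact notMem_excessRays_iff.2 (h _ (notMem_excessRays_iff.1 hcon)) hρ

end NormalFan

end GKZ

namespace GKZ

/-! ### Normal fans and GKZ pairs -/

section Pairs

variable {n : ℕ} {Δ : Set (PointedCone ℝ (Fin n → ℝ))} [Fintype (Ray Δ)]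
  (hsupp : (PointedCone.hull ℝ (Set.range (Ray.gen (Δ := Δ))) : Set (Fin n → ℝ)) = support Δ)

theorem exists_ratToReal_eq {u : Fin n → ℝ} (hu : u ∈ integralVectors (Fin n)) :
    ∃ q : Fin n → ℚ, ratToReal q = u := by
  choose k hk using hu
  exact ⟨fun i => k i, funext fun i => by simp [ratToReal, hk]⟩

theorem ratToReal_sub (p q : Fin n → ℚ) : ratToReal (p - q) = ratToReal p - ratToReal q := by
  ext i
  simp [ratToReal]

include hsupp

theorem exists_mem_normalConeAt_of_mem_support {D : WeilDivisor Δ} (v : support (normalFan D)) :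
    ∃ u ∈ poly Ray.gen D, (v : Fin n → ℝ) ∈ normalConeAt Ray.gen D u := by
  obtain ⟨v, hv⟩ := v
  obtain ⟨σ, hσ, hv⟩ := Set.mem_iUnion₂.1 hv
  obtain ⟨u, hu, rfl⟩ := (mem_normalFan_iff hsupp).1 hσ
  exact ⟨u, hu, hv⟩

/-- Compatible linear functions on the cones of the normal fan define a Cartier divisor. -/
theorem exists_mem_cartierQ {D : WeilDivisor Δ} (f : (Fin n → ℝ) → Fin n → ℚ)
    (hf : ∀ u ∈ poly Ray.gen D, ∀ w ∈ poly Ray.gen D, ∀ v ∈ normalConeAt Ray.gen D u,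
      v ∈ normalConeAt Ray.gen D w → ratToReal (f u) ⬝ᵥ v = ratToReal (f w) ⬝ᵥ v)
    {u₀ : Fin n → ℝ} (hu₀ : u₀ ∈ poly Ray.gen D) :
    ∃ ψ ∈ cartierQ (normalFan D), ∀ u ∈ poly Ray.gen D, ∀ v : support (normalFan D),
      (v : Fin n → ℝ) ∈ normalConeAt Ray.gen D u →
        ψ v = ratToReal (f u) ⬝ᵥ (v : Fin n → ℝ) - ratToReal (f u₀) ⬝ᵥ (v : Fin n → ℝ) := by
  choose a ha hav using exists_mem_normalConeAt_of_mem_support hsupp (D := D)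
  have key : ∀ u ∈ poly Ray.gen D, ∀ v : support (normalFan D),
      (v : Fin n → ℝ) ∈ normalConeAt Ray.gen D u →
      ratToReal (f (a v)) ⬝ᵥ (v : Fin n → ℝ) - ratToReal (f u₀) ⬝ᵥ (v : Fin n → ℝ) =
        ratToReal (f u) ⬝ᵥ (v : Fin n → ℝ) - ratToReal (f u₀) ⬝ᵥ (v : Fin n → ℝ) :=
    fun u hu v hv => by rw [hf _ (ha v) u hu v (hav v) hv]
  -- Subtracting the linear function of u₀ makes ψ vanish on the lineality space, which lies in the
  -- cone at u₀.
  refine ⟨fun v => ratToReal (f (a v)) ⬝ᵥ (v : Fin n → ℝ) - ratToReal (f u₀) ⬝ᵥ (v : Fin n → ℝ),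
    ⟨fun σ hσ => ?_, fun v hv => ?_⟩, key⟩
  · obtain ⟨u, hu, rfl⟩ := (mem_normalFan_iff hsupp).1 hσ
    refine ⟨f u - f u₀, fun v hv => ?_⟩
    rw [ratToReal_sub, sub_dotProduct]
    exact key u hu v hv
  · have := Set.mem_iInter₂.1 hv _ (normalConeAt_mem_normalFan hsupp hu₀)
    exact (key u₀ hu₀ v this).trans (sub_self _)

/-- D may be irrational, so it is replaced by an integral E with the same chamber, whose faces
contain integral points. Up to a linear function, ψ(v) is the minimum of v over the polyhedron of E.
-/
theorem isQuasiprojective_normalFan {D : WeilDivisor Δ} (hD : (poly Ray.gen D).Nonempty) :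
    IsQuasiprojective (normalFan D) := by
  have hg : ∀ ρ : Ray Δ, ρ.gen ∈ integralVectors (Fin n) := fun ρ => toReal_mem_integralVectors _
  obtain ⟨E, -, hDE, hE⟩ := exists_integral_chamber_eq hg hD
  have : ∀ K, ∃ q : Fin n → ℚ, IsFaceSet Ray.gen D K →
      ratToReal q ∈ poly Ray.gen E ∧ K ⊆ tightSet Ray.gen E (ratToReal q) := by
    intro K
    by_cases hK : IsFaceSet Ray.gen D K
    · obtain ⟨u, hu, huE⟩ := hE K hK
      obtain ⟨q, rfl⟩ := exists_ratToReal_eq hu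
      exact ⟨q, fun _ => huE⟩
    · exact ⟨0, fun h => absurd h hK⟩
  choose e he using this
  set f : (Fin n → ℝ) → Fin n → ℚ := fun u => e (tightSet Ray.gen D u) with hf
  have hfE : ∀ u ∈ poly Ray.gen D, ratToReal (f u) ∈ poly Ray.gen E := fun u hu =>
    (he _ (isFaceSet_tightSet hu)).1
  have hfmin : ∀ u ∈ poly Ray.gen D, ∀ v ∈ normalConeAt Ray.gen D u, ∀ w ∈ poly Ray.gen E,
      ratToReal (f u) ⬝ᵥ v ≤ w ⬝ᵥ v := fun u hu v hv w hw =>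
    dotProduct_le_of_mem_hull (he _ (isFaceSet_tightSet hu)).2 hw hv
  obtain ⟨u₀, hu₀⟩ := hD
  obtain ⟨ψ, hψ, hψf⟩ := exists_mem_cartierQ hsupp f (fun u hu w hw v hv hvw =>
    le_antisymm (hfmin _ hu _ hv _ (hfE _ hw)) (hfmin _ hw _ hvw _ (hfE _ hu))) hu₀
  refine ⟨ψ, hψ, fun σ hσ => ?_⟩
  obtain ⟨u, hu, rfl⟩ := (mem_normalFan_iff hsupp).1 hσ.prop
  refine ⟨f u - f u₀, fun v => ⟨fun hv => ?_, fun hv => ?_⟩⟩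
  · rw [ratToReal_sub, sub_dotProduct, hψf u hu v hv]
  · obtain ⟨a, ha, hav⟩ := exists_mem_normalConeAt_of_mem_support hsupp v
    rw [ratToReal_sub, sub_dotProduct, hψf a ha v hav]
    refine sub_lt_sub_right (lt_of_le_of_ne (hfmin _ ha _ hav _ (hfE u hu)) ?_) _
    intro heq
    -- Equality would put v in the normal cone of E at f(u). As D lies in the chamber of E, some
    -- cone of Σ_D contains both that cone and σ, so maximality of σ puts v in σ.
    have h1 : (v : Fin n → ℝ) ∈ normalConeAt Ray.gen E (ratToReal (f u)) :=
      (mem_normalConeAt_iff (hfE u hu)).2 ⟨((mem_normalConeAt_iff ha).1 hav).1,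
        fun w hw => heq ▸ hfmin _ ha _ hav w hw⟩
    obtain ⟨w, hw, hwT⟩ := hDE _ (isFaceSet_tightSet (hfE u hu))
    have h2 : normalConeAt Ray.gen D u ≤ normalConeAt Ray.gen D w := Submodule.span_mono
      (Set.image_mono ((he _ (isFaceSet_tightSet hu)).2.trans hwT))
    exact hv (hσ.2 (normalConeAt_mem_normalFan hsupp hw) h2
      (Submodule.span_mono (Set.image_mono hwT) h1))

theorem isGKZPair_normalFan {D : WeilDivisor Δ} (hD : (poly Ray.gen D).Nonempty) :
    IsGKZPair Δ (normalFan D) (excessRays D) where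
  fan := isPossiblyDegenerateFan_normalFan hsupp hD
  support_eq := support_normalFan hsupp hD
  quasiprojective := isQuasiprojective_normalFan hsupp hD
  spanned σ hσ := by
    obtain ⟨u, hu, rfl⟩ := (mem_normalFan_iff hsupp).1 hσ
    exact ⟨_, fun ρ hρ => notMem_excessRays_iff.2 ⟨u, hu, Set.singleton_subset_iff.2 hρ⟩, rfl⟩

/-- Each GKZ pair comes from an effective divisor. -/
theorem IsGKZPair.exists_divisor {S : Set (PointedCone ℝ (Fin n → ℝ))} {I : Set (Ray Δ)}
    (h : IsGKZPair Δ S I) : ∃ D : WeilDivisor Δ, 0 ≤ D ∧ normalFan D = S ∧ excessRays D = I := by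
  classical
  obtain ⟨ψ, hψ, hmax⟩ := h.quasiprojective
  have hle : ∀ σ ∈ S, ∃ τ, Maximal (· ∈ S) τ ∧ σ ≤ τ := fun σ hσ => by
    obtain ⟨τ, hτ, hτ'⟩ := h.fan.finite.exists_le_maximal hσ
    exact ⟨τ, hτ', hτ⟩
  have hmaxmem : ∀ v : support S, ∃ τ, Maximal (· ∈ S) τ ∧ (v : Fin n → ℝ) ∈ τ := by
    rintro ⟨v, hv⟩
    obtain ⟨σ, hσ, hv⟩ := Set.mem_iUnion₂.1 hv
    obtain ⟨τ, hτ, hστ⟩ := hle σ hσ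
    exact ⟨τ, hτ, hστ hv⟩
  have hmaxle : ∀ u : Fin n → ℚ, ∀ σ : PointedCone ℝ (Fin n → ℝ),
      (∀ v : support S, ((v : Fin n → ℝ) ∈ σ → ψ v = ratToReal u ⬝ᵥ (v : Fin n → ℝ)) ∧
      ((v : Fin n → ℝ) ∉ σ → ψ v < ratToReal u ⬝ᵥ (v : Fin n → ℝ))) →
      ∀ v : support S, ψ v ≤ ratToReal u ⬝ᵥ (v : Fin n → ℝ) := by
    intro u σ hu v
    by_cases hv : (v : Fin n → ℝ) ∈ σ
    · exact ((hu v).1 hv).le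
    · exact ((hu v).2 hv).le
  obtain ⟨σ₁, hσ₁⟩ := h.fan.nonempty
  obtain ⟨σ₀, hσ₀, -⟩ := hle σ₁ hσ₁
  obtain ⟨u₀, hu₀⟩ := hmax σ₀ hσ₀
  let G : Ray Δ → support S := fun ρ => ⟨ρ.gen, h.support_eq ▸ gen_mem_support ρ⟩
  have hI : ∀ ρ, (0 : ℝ) ≤ if ρ ∈ I then 1 else 0 := fun ρ => by split_ifs <;> simp
  -- The divisor of −(ψ − u₀), effective because ψ ≤ u₀, with 1 added on I so that the inequalities
  -- there are never tight.
  set D : WeilDivisor Δ := fun ρ =>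
    ratToReal u₀ ⬝ᵥ ρ.gen - ψ (G ρ) + if ρ ∈ I then 1 else 0 with hD
  have hD0 : 0 ≤ D := fun ρ => by
    have h1 : ψ (G ρ) ≤ ratToReal u₀ ⬝ᵥ ρ.gen := hmaxle u₀ σ₀ hu₀ (G ρ)
    have h2 := hI ρ
    change 0 ≤ ratToReal u₀ ⬝ᵥ ρ.gen - ψ (G ρ) + if ρ ∈ I then 1 else 0
    linarith
  have hDne : (poly Ray.gen D).Nonempty := ⟨0, fun ρ => by simpa using hD0 ρ⟩
  -- Every cone of Σ is spanned by rays outside I, where the inequalities of D say a ≥ ψ − u₀;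
  -- linearity on the cone does the rest.
  have hpoly : ∀ a ∈ poly Ray.gen D, ∀ v : support S,
      ψ v - ratToReal u₀ ⬝ᵥ (v : Fin n → ℝ) ≤ a ⬝ᵥ (v : Fin n → ℝ) := by
    rintro a ha ⟨v, hv⟩
    obtain ⟨τ, hτ, hvτ⟩ := Set.mem_iUnion₂.1 hv
    obtain ⟨u, hu⟩ := hψ.1 τ hτ
    obtain ⟨J, hJ, hτJ⟩ := h.spanned τ hτ
    have h1 := dotProduct_nonneg_of_mem_hull (w := a - ratToReal u + ratToReal u₀) (K := J)
      (fun ρ hρ => by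
        have h2 : ψ (G ρ) = ratToReal u ⬝ᵥ ρ.gen :=
          hu (G ρ) (hτJ ▸ Submodule.subset_span ⟨ρ, hρ, rfl⟩)
        have h3 : -(ratToReal u₀ ⬝ᵥ ρ.gen - ψ (G ρ) + if ρ ∈ I then 1 else 0) ≤ a ⬝ᵥ ρ.gen := ha ρ
        rw [if_neg (hJ hρ)] at h3
        rw [add_dotProduct, sub_dotProduct]
        linarith) (hτJ ▸ hvτ)
    rw [add_dotProduct, sub_dotProduct] at h1
    rw [hu ⟨v, hv⟩ hvτ]
    change ratToReal u ⬝ᵥ v - ratToReal u₀ ⬝ᵥ v ≤ a ⬝ᵥ v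
    linarith
  -- The vertex for σ is u_σ − u₀: it attains the lower bound ψ − u₀ on σ, and by strict convexity
  -- nowhere else.
  have hmaxpoly : ∀ σ, Maximal (· ∈ S) σ → ∃ w ∈ poly Ray.gen D, normalConeAt Ray.gen D w = σ ∧
      ∀ v : support S, (v : Fin n → ℝ) ∈ σ →
        w ⬝ᵥ (v : Fin n → ℝ) = ψ v - ratToReal u₀ ⬝ᵥ (v : Fin n → ℝ) := by
    have hw : ∀ (σ) (u : Fin n → ℚ),
        (∀ v : support S, ((v : Fin n → ℝ) ∈ σ → ψ v = ratToReal u ⬝ᵥ (v : Fin n → ℝ)) ∧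
          ((v : Fin n → ℝ) ∉ (σ : PointedCone ℝ (Fin n → ℝ)) →
            ψ v < ratToReal u ⬝ᵥ (v : Fin n → ℝ))) →
        ratToReal u - ratToReal u₀ ∈ poly Ray.gen D := by
      intro σ u hu ρ
      have h1 : ψ (G ρ) ≤ ratToReal u ⬝ᵥ ρ.gen := hmaxle u σ hu (G ρ)
      have h2 := hI ρ
      rw [sub_dotProduct]
      change -(ratToReal u₀ ⬝ᵥ ρ.gen - ψ (G ρ) + if ρ ∈ I then 1 else 0) ≤ _
      linarith
    intro σ hσ
    obtain ⟨u, hu⟩ := hmax σ hσ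
    refine ⟨_, hw σ u hu, ?_, fun v hv => by rw [sub_dotProduct, (hu v).1 hv]⟩
    ext v
    rw [mem_normalConeAt_iff (hw σ u hu)]
    constructor
    · rintro ⟨hv, hmin⟩
      have hvS : v ∈ support S := by rw [h.support_eq, ← hsupp]; exact hv
      by_contra hvσ
      obtain ⟨τ, hτ, hvτ⟩ := hmaxmem ⟨v, hvS⟩
      obtain ⟨u', hu'⟩ := hmax τ hτ
      have h1 := hmin _ (hw τ u' hu')
      have h2 := (hu' ⟨v, hvS⟩).1 hvτ
      have h3 := (hu ⟨v, hvS⟩).2 hvσ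
      rw [sub_dotProduct, sub_dotProduct] at h1
      change _ = ratToReal u' ⬝ᵥ v at h2
      change _ < ratToReal u ⬝ᵥ v at h3
      linarith
    · intro hv
      have hvS : v ∈ support S := Set.mem_biUnion hσ.prop hv
      refine ⟨by rw [← SetLike.mem_coe, hsupp, ← h.support_eq]; exact hvS, fun a ha => ?_⟩
      have h1 := hpoly a ha ⟨v, hvS⟩
      rw [(hu ⟨v, hvS⟩).1 hv] at h1
      rw [sub_dotProduct]
      exact h1
  have hfan := isPossiblyDegenerateFan_normalFan hsupp hDne
  have hsub : S ⊆ normalFan D := by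
    intro τ hτ
    obtain ⟨σ, hσ, hτσ⟩ := hle τ hτ
    obtain ⟨w, hw, hwσ, -⟩ := hmaxpoly σ hσ
    have h1 : τ.IsFaceOf σ := by
      have := h.fan.inter_right τ hτ σ hσ.prop
      rwa [inf_eq_left.2 hτσ] at this
    exact hfan.face_mem σ (hwσ ▸ normalConeAt_mem_normalFan hsupp hw) τ h1
  refine ⟨D, hD0, subset_antisymm (fun τ hτ => ?_) hsub, ?_⟩
  -- The cones of Σ already cover the support, so τ is a finite union of its faces τ ∩ σ. It equals
  -- one of them, which makes it a face of a cone of Σ.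
  · obtain ⟨σ, hσ, heq⟩ := exists_eq_of_subset_iUnion_faces h.fan.finite.toFinset
      (fun σ => τ ⊓ σ) τ (fun σ hσ => hfan.inter_left τ hτ σ (hsub (by simpa using hσ)))
      (fun x hx => by
        have : x ∈ support S := by
          rw [h.support_eq, ← support_normalFan hsupp hDne]
          exact Set.mem_biUnion hτ hx
        obtain ⟨σ, hσ, hxσ⟩ := Set.mem_iUnion₂.1 this
        exact ⟨σ, by simpa using hσ, hx, hxσ⟩)
    have hσS : σ ∈ S := by simpa using hσ
    have h1 := hfan.inter_right τ hτ σ (hsub hσS)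
    rw [heq] at h1
    exact h.fan.face_mem σ hσS τ h1
  · ext ρ
    by_cases hρ : ρ ∈ I
    · refine iff_of_true ?_ hρ
      by_contra hcon
      obtain ⟨a, ha, haρ⟩ := notMem_excessRays_iff.1 hcon
      have h1 : a ⬝ᵥ ρ.gen = -(ratToReal u₀ ⬝ᵥ ρ.gen - ψ (G ρ) + if ρ ∈ I then 1 else 0) := haρ rfl
      have h2 : ψ (G ρ) - ratToReal u₀ ⬝ᵥ ρ.gen ≤ a ⬝ᵥ ρ.gen := hpoly a ha (G ρ)
      rw [if_pos hρ] at h1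
      linarith
    · refine iff_of_false (notMem_excessRays_iff.2 ?_) hρ
      obtain ⟨σ, hσ, hρσ⟩ := hmaxmem (G ρ)
      obtain ⟨w, hw, -, hwσ⟩ := hmaxpoly σ hσ
      refine ⟨w, hw, Set.singleton_subset_iff.2 ?_⟩
      have h1 : w ⬝ᵥ ρ.gen = ψ (G ρ) - ratToReal u₀ ⬝ᵥ ρ.gen := hwσ (G ρ) hρσ
      change w ⬝ᵥ ρ.gen = -(ratToReal u₀ ⬝ᵥ ρ.gen - ψ (G ρ) + if ρ ∈ I then 1 else 0)
      rw [h1, if_neg hρ]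
      ring

end Pairs

end GKZ

namespace GKZ

/-! ### Dimensions -/

/-! ### Rational subspaces of real vector spaces. -/

section Rational

/-- Coordinatewise inclusion of rational vectors in real vectors. -/
def ratCastLinear (κ : Type*) : (κ → ℚ) →ₗ[ℚ] (κ → ℝ) where
  toFun q i := q i
  map_add' p q := by ext; simp
  map_smul' c q := by ext; simp [Rat.smul_def]

theorem ratCastLinear_injective (κ : Type*) : Function.Injective (ratCastLinear κ) :=
  fun _ _ h => funext fun i => Rat.cast_injective (congrFun h i)

variable {κ : Type*} [Finite κ]

theorem finite_of_le_range_ratCast {M : Submodule ℚ (κ → ℝ)}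
    (hM : M ≤ LinearMap.range (ratCastLinear κ)) : Module.Finite ℚ M :=
  Submodule.finiteDimensional_of_le hM

/-- A rational subspace has the same dimension as the real subspace that it spans. -/
theorem finrank_span_eq_finrank {M : Submodule ℚ (κ → ℝ)}
    (hM : M ≤ LinearMap.range (ratCastLinear κ)) :
    Module.finrank ℝ (Submodule.span ℝ (M : Set (κ → ℝ))) = Module.finrank ℚ M := by
  set N : Submodule ℚ (κ → ℚ) := M.comap (ratCastLinear κ) with hN
  have hMN : N.map (ratCastLinear κ) = M := by
    rw [hN, Submodule.map_comap_eq, inf_eq_right.2 hM]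
  let b := Module.finBasis ℚ N
  have hb : LinearIndependent ℝ fun i => algebraMap ℚ ℝ ∘ (b i : κ → ℚ) :=
    linearIndependent_algebraMap_comp_iff.2
      (b.linearIndependent.map' N.subtype (Submodule.ker_subtype N))
  have hspan : Submodule.span ℝ (M : Set (κ → ℝ)) =
      Submodule.span ℝ (Set.range fun i => algebraMap ℚ ℝ ∘ (b i : κ → ℚ)) := by
    refine le_antisymm (Submodule.span_le.2 ?_) (Submodule.span_mono ?_)
    · rw [← hMN]
      rintro _ ⟨y, hy, rfl⟩
      have hy' : y = ∑ i, b.repr ⟨y, hy⟩ i • (b i : κ → ℚ) := by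
        have := congrArg Subtype.val (b.sum_repr ⟨y, hy⟩)
        simpa only [AddSubmonoidClass.coe_finsetSum, Submodule.coe_smul] using this.symm
      rw [hy', map_sum]
      refine Submodule.sum_mem _ fun i _ => ?_
      rw [map_smul, ← algebraMap_smul ℝ (b.repr ⟨y, hy⟩ i)]
      exact Submodule.smul_mem _ _ (Submodule.subset_span ⟨i, rfl⟩)
    · rintro _ ⟨i, rfl⟩
      exact (b i).2
  rw [hspan, finrank_span_eq_card hb, Fintype.card_fin, ← hMN,
    ← (Submodule.equivMapOfInjective _ (ratCastLinear_injective κ) N).finrank_eq]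

end Rational

/-! ### The linear span of a chamber. -/

section Configuration

variable {ι : Type*} {n : ℕ} {g : ι → Fin n → ℝ}

variable (g) in
/-- The rational vectors that are given on each normal cone of `poly g D` by a rational linear
function. -/
def piecewiseLinearQ (D : ι → ℝ) : Submodule ℚ (ι → ℝ) where
  carrier := {E | E ∈ LinearMap.range (ratCastLinear ι) ∧ ∀ K, IsFaceSet g D K →
    ∃ w : Fin n → ℚ, ∀ i ∈ K, ratToReal w ⬝ᵥ g i = E i}
  zero_mem' := ⟨zero_mem _, fun K _ => ⟨0, fun i _ => by simp [ratToReal, dotProduct]⟩⟩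
  add_mem' := by
    rintro E F ⟨hE, hE'⟩ ⟨hF, hF'⟩
    refine ⟨add_mem hE hF, fun K hK => ?_⟩
    obtain ⟨u, hu⟩ := hE' K hK
    obtain ⟨w, hw⟩ := hF' K hK
    refine ⟨u + w, fun i hi => ?_⟩
    rw [Pi.add_apply, ← hu i hi, ← hw i hi]
    simp [ratToReal, dotProduct, add_mul, Finset.sum_add_distrib]
  smul_mem' := by
    rintro c E ⟨hE, hE'⟩
    refine ⟨Submodule.smul_mem _ _ hE, fun K hK => ?_⟩
    obtain ⟨u, hu⟩ := hE' K hK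
    refine ⟨c • u, fun i hi => ?_⟩
    rw [Pi.smul_apply, ← hu i hi]
    simp [ratToReal, dotProduct, Finset.mul_sum, mul_assoc, Rat.smul_def]

theorem piecewiseLinearQ_le (D : ι → ℝ) :
    piecewiseLinearQ g D ≤ LinearMap.range (ratCastLinear ι) := fun _ h => h.1

/-- The integral generators of the chamber come with integral linear functions on each face set, so
they lie in the rational space; the converse is `mem_span_chamber`. -/
theorem span_chamber_eq [Fintype ι] (hg : ∀ i, g i ∈ integralVectors (Fin n)) (D : ι → ℝ) :
    Submodule.span ℝ (chamber g D : Set (ι → ℝ)) =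
      Submodule.span ℝ (piecewiseLinearQ g D : Set (ι → ℝ)) := by
  refine le_antisymm (Submodule.span_le.2 ?_) (Submodule.span_le.2 ?_)
  · obtain ⟨S, hS, hSi⟩ := exists_hull_eq_chamber hg D
    rw [← hS]
    refine subset_trans (PointedCone.hull_le_span (R := ℝ) (S : Set (ι → ℝ)))
      (Submodule.span_mono fun E hE => ?_)
    obtain ⟨hEi, hEK⟩ := hSi E hE
    choose k hk using hEi
    refine ⟨⟨fun i => k i, funext fun i => by simp [ratCastLinear, hk]⟩, fun K hK => ?_⟩
    obtain ⟨u, hu, -, huK⟩ := hEK K hK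
    obtain ⟨q, hq⟩ := exists_ratToReal_eq (neg_mem hu)
    refine ⟨q, fun i hi => ?_⟩
    have : u ⬝ᵥ g i = -E i := huK hi
    rw [hq, neg_dotProduct, this, neg_neg]
  · rintro E ⟨-, hE⟩
    refine mem_span_chamber fun K hK => ?_
    obtain ⟨w, hw⟩ := hE K hK
    exact ⟨-ratToReal w, fun i hi => by rw [neg_dotProduct, hw i hi]⟩

theorem finrank_span_chamber [Fintype ι] (hg : ∀ i, g i ∈ integralVectors (Fin n)) (D : ι → ℝ) :
    Module.finrank ℝ (Submodule.span ℝ (chamber g D : Set (ι → ℝ))) =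
      Module.finrank ℚ (piecewiseLinearQ g D) := by
  rw [span_chamber_eq hg, finrank_span_eq_finrank (piecewiseLinearQ_le D)]

end Configuration

/-! ### Cartier divisors, excess rays and the dimension count. -/

section Picard

variable {n : ℕ} {Δ S : Set (PointedCone ℝ (Fin n → ℝ))} {I : Set (Ray Δ)}

/-- The generator of a ray as a point of the support of a fan with the same support. -/
def genSupport (hS : support S = support Δ) (ρ : Ray Δ) : support S :=
  ⟨ρ.gen, hS ▸ gen_mem_support ρ⟩

open Classical in
/-- The Weil divisor defined by a Cartier divisor, multiplicities of the rays in `I`, and a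
linear function. -/
noncomputable def weilOfCartier (hS : support S = support Δ) (I : Set (Ray Δ)) :
    (cartierQ S × (I → ℚ) × (Fin n → ℚ)) →ₗ[ℚ] WeilDivisor Δ where
  toFun x ρ := x.1.1 (genSupport hS ρ) + (if h : ρ ∈ I then (x.2.1 ⟨ρ, h⟩ : ℝ) else 0) +
    ratToReal x.2.2 ⬝ᵥ ρ.gen
  map_add' x y := by
    ext ρ
    have : ratToReal (x.2.2 + y.2.2) = ratToReal x.2.2 + ratToReal y.2.2 := by
      ext; simp [ratToReal]
    simp only [Prod.fst_add, Prod.snd_add, Submodule.coe_add, Pi.add_apply, this, add_dotProduct]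
    split_ifs
    · push_cast; ring
    · ring
  map_smul' c x := by
    ext ρ
    have : ratToReal (c • x.2.2) = (c : ℝ) • ratToReal x.2.2 := by
      ext; simp [ratToReal]
    simp only [Prod.smul_fst, Prod.smul_snd, Submodule.coe_smul, Pi.smul_apply, this,
      smul_dotProduct, RingHom.id_apply, Rat.smul_def, smul_eq_mul]
    split_ifs
    · push_cast; ring
    · ring

open Classical in
theorem weilOfCartier_apply (hS : support S = support Δ) (x) (ρ : Ray Δ) :
    weilOfCartier hS I x ρ = x.1.1 (genSupport hS ρ) +
      (if h : ρ ∈ I then (x.2.1 ⟨ρ, h⟩ : ℝ) else 0) + ratToReal x.2.2 ⬝ᵥ ρ.gen := rfl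

theorem exists_rat_eq_dotProduct_gen (u : Fin n → ℚ) (ρ : Ray Δ) :
    ∃ q : ℚ, (q : ℝ) = ratToReal u ⬝ᵥ ρ.gen :=
  ⟨∑ i, u i * ρ.1 i, by simp [ratToReal, dotProduct, Ray.gen, toReal]⟩

theorem exists_rat_eq_cartierQ (hS : support S = support Δ) (ψ : cartierQ S) (ρ : Ray Δ) :
    ∃ q : ℚ, (q : ℝ) = ψ.1 (genSupport hS ρ) := by
  obtain ⟨σ, hσ, hρ⟩ := Set.mem_iUnion₂.1 (genSupport hS ρ).2
  obtain ⟨u, hu⟩ := ψ.2.1 σ hσ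
  rw [hu _ hρ]
  exact exists_rat_eq_dotProduct_gen u ρ

variable [Fintype (Ray Δ)]
  (hsupp : (PointedCone.hull ℝ (Set.range (Ray.gen (Δ := Δ))) : Set (Fin n → ℝ)) = support Δ)

include hsupp

omit hsupp [Fintype (Ray Δ)] in
theorem notMem_excessRays_of_mem_tightSet {D : WeilDivisor Δ} {u : Fin n → ℝ}
    (hu : u ∈ poly Ray.gen D) {ρ : Ray Δ} (hρ : ρ ∈ tightSet Ray.gen D u) : ρ ∉ excessRays D :=
  notMem_excessRays_iff.2 ⟨u, hu, Set.singleton_subset_iff.2 hρ⟩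

/-- Rays in I_D belong to no face set, so their values are free. On the other rays, linearity on
each face set means being a Cartier divisor plus a linear function. -/
theorem range_weilOfCartier {D : WeilDivisor Δ} (hD : (poly Ray.gen D).Nonempty)
    (hS : support (normalFan D) = support Δ) :
    LinearMap.range (weilOfCartier hS (excessRays D)) = piecewiseLinearQ Ray.gen D := by
  classical
  apply le_antisymm
  · rintro _ ⟨⟨ψ, e, u⟩, rfl⟩
    constructor
    · have : ∀ ρ, ∃ q : ℚ, (q : ℝ) = weilOfCartier hS (excessRays D) (ψ, e, u) ρ := by
        intro ρ
        obtain ⟨p, hp⟩ := exists_rat_eq_cartierQ hS ψ ρ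
        obtain ⟨q, hq⟩ := exists_rat_eq_dotProduct_gen u ρ
        refine ⟨p + (if h : ρ ∈ excessRays D then e ⟨ρ, h⟩ else 0) + q, ?_⟩
        rw [weilOfCartier_apply, ← hp, ← hq]
        push_cast
        split_ifs <;> simp
      choose q hq using this
      exact ⟨q, funext hq⟩
    · rintro K ⟨a, ha, haK⟩
      obtain ⟨w, hw⟩ := ψ.2.1 _ (normalConeAt_mem_normalFan hsupp ha)
      refine ⟨w + u, fun ρ hρ => ?_⟩
      rw [weilOfCartier_apply, dif_neg (notMem_excessRays_of_mem_tightSet ha (haK hρ)), add_zero,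
        hw _ (Submodule.subset_span ⟨ρ, haK hρ, rfl⟩)]
      simp [genSupport, ratToReal, dotProduct, add_mul, Finset.sum_add_distrib]
  · rintro E ⟨⟨q, hq⟩, hE⟩
    have : ∀ K, ∃ w : Fin n → ℚ, IsFaceSet Ray.gen D K →
        ∀ ρ ∈ K, ratToReal w ⬝ᵥ ρ.gen = E ρ := by
      intro K
      by_cases hK : IsFaceSet Ray.gen D K
      · obtain ⟨w, hw⟩ := hE K hK
        exact ⟨w, fun _ => hw⟩
      · exact ⟨0, fun h => absurd h hK⟩
    choose w hw using this
    have hwT : ∀ u ∈ poly Ray.gen D, ∀ ρ ∈ tightSet Ray.gen D u,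
        ratToReal (w (tightSet Ray.gen D u)) ⬝ᵥ ρ.gen = E ρ := fun u hu =>
      hw _ (isFaceSet_tightSet hu)
    obtain ⟨u₀, hu₀⟩ := hD
    obtain ⟨ψ, hψ, hψf⟩ := exists_mem_cartierQ hsupp (fun u => w (tightSet Ray.gen D u))
      (fun u hu a ha v hv hva => dotProduct_eq_of_mem_hull
        (fun ρ hρ => (hwT u hu ρ hρ.1).trans (hwT a ha ρ hρ.2).symm)
        (mem_normalConeAt_inter hu ha hv hva)) hu₀
    choose p hp using exists_rat_eq_cartierQ hS ⟨ψ, hψ⟩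
    choose r hr using exists_rat_eq_dotProduct_gen (Δ := Δ) (w (tightSet Ray.gen D u₀))
    -- The last component restores the linear function of u₀ that was subtracted in ψ; the middle
    -- one corrects the values on I_D.
    refine ⟨(⟨ψ, hψ⟩, fun ρ => q ρ - p ρ - r ρ, w (tightSet Ray.gen D u₀)), ?_⟩
    ext ρ
    rw [weilOfCartier_apply]
    split_ifs with hρ
    · push_cast
      rw [hp, hr, show (q ρ : ℝ) = E ρ from congrFun hq ρ]
      ring
    · obtain ⟨u, hu, hρu⟩ := notMem_excessRays_iff.1 hρ
      have hρu' : ρ ∈ tightSet Ray.gen D u := hρu rfl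
      have := hψf u hu (genSupport hS ρ) (Submodule.subset_span ⟨ρ, hρu', rfl⟩)
      change ψ (genSupport hS ρ) + 0 + _ = _
      rw [this]
      have h2 := hwT u hu ρ hρu'
      change ratToReal (w (tightSet Ray.gen D u)) ⬝ᵥ ρ.gen - _ + 0 + _ = _
      rw [h2]
      simp [genSupport]

theorem cartier_eq_of_mem_ker {D : WeilDivisor Δ} (hS : support (normalFan D) = support Δ) {x}
    (hx : weilOfCartier hS (excessRays D) x = 0) (v : support (normalFan D)) :
    x.1.1 v = ratToReal (-x.2.2) ⬝ᵥ (v : Fin n → ℝ) := by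
  classical
  obtain ⟨u, hu, hv⟩ := exists_mem_normalConeAt_of_mem_support hsupp v
  obtain ⟨w, hw⟩ := x.1.2.1 _ (normalConeAt_mem_normalFan hsupp hu)
  rw [hw v hv]
  refine dotProduct_eq_of_mem_hull (fun ρ hρ => ?_) hv
  have h1 := congrFun hx ρ
  rw [weilOfCartier_apply, dif_neg (notMem_excessRays_of_mem_tightSet hu hρ), add_zero,
    hw _ (Submodule.subset_span ⟨ρ, hρ, rfl⟩)] at h1
  have h2 : ratToReal (-x.2.2) = -ratToReal x.2.2 := by ext; simp [ratToReal]
  rw [h2, neg_dotProduct]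
  exact eq_neg_of_add_eq_zero_left h1

variable (hinj : ∀ u : Fin n → ℝ, (∀ ρ : Ray Δ, u ⬝ᵥ ρ.gen = 0) → u = 0)

include hinj

/-- The kernel projects isomorphically onto the principal divisors. A kernel element has ψ = −u; if
ψ = 0, then u vanishes because the rays span, and so do the multiplicities. -/
theorem finrank_ker_weilOfCartier {D : WeilDivisor Δ} (hS : support (normalFan D) = support Δ) :
    Module.finrank ℚ (LinearMap.ker (weilOfCartier hS (excessRays D))) =
      Module.finrank ℚ (principalQ (normalFan D)) := by
  classical
  set T := weilOfCartier hS (excessRays D) with hT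
  set π := (LinearMap.fst ℚ (cartierQ (normalFan D))
    ((excessRays D → ℚ) × (Fin n → ℚ))).domRestrict (LinearMap.ker T) with hπ
  have hker : ∀ z : LinearMap.ker T, z.1.1 = 0 → z = 0 := by
    rintro ⟨⟨ψ, e, u⟩, hx⟩ h0
    obtain rfl : ψ = 0 := h0
    have h1 := cartier_eq_of_mem_ker hsupp hS (x := (0, e, u)) hx
    have hu : ratToReal (-u) = 0 := hinj _ fun ρ => (h1 (genSupport hS ρ)).symm
    have hu0 : u = 0 := by
      ext i
      have := congrFun hu i
      simpa [ratToReal] using this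
    subst hu0
    have he : e = 0 := by
      ext ⟨ρ, hρ⟩
      have h2 := congrFun (show weilOfCartier hS (excessRays D) (0, e, 0) = 0 from hx) ρ
      rw [weilOfCartier_apply, dif_pos hρ] at h2
      simpa [ratToReal, dotProduct] using h2
    subst he
    rfl
  have hπinj : Function.Injective π := fun x y hxy =>
    sub_eq_zero.1 (hker (x - y) (sub_eq_zero.2 hxy))
  have hrange : LinearMap.range π = principalQ (normalFan D) := by
    ext ψ
    constructor
    · rintro ⟨⟨x, hx⟩, rfl⟩
      exact ⟨-x.2.2, cartier_eq_of_mem_ker hsupp hS hx⟩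
    · rintro ⟨u, hu⟩
      refine ⟨⟨(ψ, 0, -u), ?_⟩, rfl⟩
      rw [LinearMap.mem_ker]
      ext ρ
      rw [hT, weilOfCartier_apply, hu]
      simp [ratToReal, genSupport, dotProduct]
  rw [← hrange, LinearMap.finrank_range_of_inj hπinj]

theorem finrank_piecewiseLinearQ {D : WeilDivisor Δ} (hD : (poly Ray.gen D).Nonempty) :
    Module.finrank ℚ (piecewiseLinearQ Ray.gen D) =
      Module.finrank ℚ (PicQ (normalFan D)) + (excessRays D).ncard + n := by
  classical
  have hS := support_normalFan hsupp hD
  set T := weilOfCartier hS (excessRays D) with hT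
  have hrange : LinearMap.range T = piecewiseLinearQ Ray.gen D := range_weilOfCartier hsupp hD hS
  have hWfin : Module.Finite ℚ (piecewiseLinearQ (Ray.gen (Δ := Δ)) D) :=
    finite_of_le_range_ratCast (piecewiseLinearQ_le D)
  -- Rank–nullity needs finite dimension, although Cartier divisors are functions on an infinite
  -- set. They are determined by their values on the rays.
  have hCfin : Module.Finite ℚ (cartierQ (normalFan D)) := by
    have hinjT : Function.Injective ((T ∘ₗ LinearMap.inl ℚ (cartierQ (normalFan D))
        ((excessRays D → ℚ) × (Fin n → ℚ))).codRestrict (piecewiseLinearQ Ray.gen D)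
        fun x => hrange ▸ ⟨_, rfl⟩) := by
      rw [← LinearMap.ker_eq_bot, LinearMap.ker_eq_bot']
      intro ψ hψ
      have h1 := cartier_eq_of_mem_ker hsupp hS (x := (ψ, 0, 0)) (Subtype.ext_iff.1 hψ)
      ext v
      rw [h1]
      simp [ratToReal, dotProduct]
    exact Module.Finite.of_injective _ hinjT
  have h1 := LinearMap.finrank_range_add_finrank_ker T
  rw [finrank_ker_weilOfCartier hsupp hinj hS, hrange, Module.finrank_prod, Module.finrank_prod,
    Module.finrank_fintype_fun_eq_card, Module.finrank_fin_fun,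
    ← Nat.card_eq_fintype_card] at h1
  have h2 := Submodule.finrank_quotient_add_finrank (principalQ (normalFan D))
  have h3 : Nat.card (excessRays D) = (excessRays D).ncard := Nat.card_coe_set_eq _
  change Module.finrank ℚ (PicQ (normalFan D)) + _ = _ at h2
  rw [h3] at h1
  refine Nat.add_right_cancel (m := Module.finrank ℚ (principalQ (normalFan D))) (h1.trans ?_)
  rw [← h2]
  ring

/-- The dimension of the image of a chamber in the class group. -/
theorem finrank_span_image_chamber {D : WeilDivisor Δ} (hD : (poly Ray.gen D).Nonempty) :
    Module.finrank ℝ (Submodule.span ℝ (cls Δ '' (chamber Ray.gen D : Set (WeilDivisor Δ)))) =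
      Module.finrank ℚ (PicQ (normalFan D)) + (excessRays D).ncard := by
  have hg : ∀ ρ : Ray Δ, ρ.gen ∈ integralVectors (Fin n) := fun ρ => toReal_mem_integralVectors _
  set L := LinearMap.range (divisorOf Δ) with hL
  set W := Submodule.span ℝ (chamber Ray.gen D : Set (WeilDivisor Δ)) with hW
  -- The span of the chamber contains all linear functions, so its image in the class group loses
  -- exactly their n dimensions.
  have hLW : L ≤ W := by
    rintro _ ⟨u, rfl⟩
    refine mem_span_chamber fun K _ => ⟨-u, fun ρ _ => ?_⟩
    rw [neg_dotProduct]
    rfl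
  have hLn : Module.finrank ℝ L = n := by
    rw [hL, LinearMap.finrank_range_of_inj, Module.finrank_fin_fun]
    rw [← LinearMap.ker_eq_bot, LinearMap.ker_eq_bot']
    exact fun u hu => hinj u fun ρ => congrFun hu ρ
  have hWn : Module.finrank ℝ W = _ :=
    (finrank_span_chamber hg D).trans (finrank_piecewiseLinearQ hsupp hinj hD)
  have hmap : Submodule.span ℝ (cls Δ '' (chamber Ray.gen D : Set (WeilDivisor Δ))) =
      LinearMap.range (L.mkQ.domRestrict W) := by
    rw [LinearMap.range_domRestrict, hW, Submodule.map_span]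
    rfl
  have hker : LinearMap.ker (L.mkQ.domRestrict W) = L.comap W.subtype := by
    rw [LinearMap.domRestrict, LinearMap.ker_comp, Submodule.ker_mkQ]
  have h1 := LinearMap.finrank_range_add_finrank_ker (L.mkQ.domRestrict W)
  rw [hker, (Submodule.comapSubtypeEquivOfLe hLW).finrank_eq, hLn, hWn, ← hmap] at h1
  exact Nat.add_right_cancel h1

end Picard

end GKZ

namespace GKZ

/-! ### The GKZ fan -/

section GKZFan

variable {n : ℕ} {Δ : Set (PointedCone ℝ (Fin n → ℝ))}

/-- The image of a chamber in the class group. -/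
def gammaCone (D : WeilDivisor Δ) : PointedCone ℝ (ClassGroup Δ) :=
  PointedCone.map (LinearMap.range (divisorOf Δ)).mkQ (chamber Ray.gen D)

theorem coe_gammaCone (D : WeilDivisor Δ) :
    (gammaCone D : Set (ClassGroup Δ)) = cls Δ '' (chamber Ray.gen D : Set (WeilDivisor Δ)) := rfl

theorem cls_eq_cls_iff {D E : WeilDivisor Δ} :
    cls Δ D = cls Δ E ↔ ∃ u : Fin n → ℝ, D = E + fun ρ => u ⬝ᵥ ρ.gen := by
  rw [cls, cls, Submodule.Quotient.eq]
  constructor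
  · rintro ⟨u, hu⟩
    exact ⟨u, by rw [← sub_eq_iff_eq_add', ← hu]; rfl⟩
  · rintro ⟨u, rfl⟩
    exact ⟨u, by rw [add_sub_cancel_left]; rfl⟩

/-- Chambers are unions of full divisor classes. Hence questions about faces can be pulled back
along the surjection to the class group. -/
theorem cls_mem_gammaCone {D E : WeilDivisor Δ} : cls Δ E ∈ gammaCone D ↔ E ∈ chamber Ray.gen D := by
  rw [← SetLike.mem_coe, coe_gammaCone]
  constructor
  · rintro ⟨F, hF, hFE⟩
    obtain ⟨u, rfl⟩ := cls_eq_cls_iff.1 hFE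
    exact (add_linear_mem_chamber u).1 hF
  · exact fun h => ⟨E, h, rfl⟩

theorem comap_gammaCone (D : WeilDivisor Δ) :
    PointedCone.comap (LinearMap.range (divisorOf Δ)).mkQ (gammaCone D) = chamber Ray.gen D := by
  ext E
  exact cls_mem_gammaCone

theorem cls_surjective : Function.Surjective (cls Δ) := Submodule.Quotient.mk_surjective _

theorem gammaCone_isFaceOf_iff {G : PointedCone ℝ (ClassGroup Δ)} {D : WeilDivisor Δ} :
    G.IsFaceOf (gammaCone D) ↔
      (PointedCone.comap (LinearMap.range (divisorOf Δ)).mkQ G).IsFaceOf (chamber Ray.gen D) := by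
  rw [← comap_gammaCone, PointedCone.isFaceOf_comap_iff (Submodule.mkQ_surjective _)]

theorem poly_nonempty_of_nonneg {D : WeilDivisor Δ} (hD : 0 ≤ D) : (poly Ray.gen D).Nonempty :=
  ⟨0, fun ρ => by simpa using hD ρ⟩

theorem exists_nonneg_cls_eq {D : WeilDivisor Δ} (hD : (poly Ray.gen D).Nonempty) :
    ∃ E : WeilDivisor Δ, 0 ≤ E ∧ cls Δ E = cls Δ D := by
  obtain ⟨u, hu⟩ := hD
  refine ⟨_, fun ρ => ?_, cls_eq_cls_iff.2 ⟨u, rfl⟩⟩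
  have := hu ρ
  change 0 ≤ D ρ + u ⬝ᵥ ρ.gen
  linarith

variable [Fintype (Ray Δ)]

theorem isFaceOf_gammaCone_iff_mem {D E : WeilDivisor Δ} (hD : (poly Ray.gen D).Nonempty) :
    (gammaCone E).IsFaceOf (gammaCone D) ↔ E ∈ chamber Ray.gen D := by
  rw [gammaCone_isFaceOf_iff, comap_gammaCone]
  exact ⟨fun h => h.le (self_mem_chamber E), chamber_isFaceOf hD⟩

theorem exists_eq_gammaCone_of_isFaceOf {D : WeilDivisor Δ} (hD : (poly Ray.gen D).Nonempty)
    {G : PointedCone ℝ (ClassGroup Δ)} (hG : G.IsFaceOf (gammaCone D)) :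
    ∃ E ∈ chamber Ray.gen D, G = gammaCone E := by
  obtain ⟨E, hE, hGE⟩ := exists_eq_chamber_of_isFaceOf hD (gammaCone_isFaceOf_iff.1 hG)
  refine ⟨E, hE, ?_⟩
  ext c
  obtain ⟨F, rfl⟩ := cls_surjective c
  rw [cls_mem_gammaCone, ← hGE]
  rfl

theorem isRationalPolyhedral_gammaCone (D : WeilDivisor Δ) :
    IsRationalPolyhedral (integralClasses Δ) (gammaCone D) := by
  classical
  have hg : ∀ ρ : Ray Δ, ρ.gen ∈ integralVectors (Fin n) := fun ρ => toReal_mem_integralVectors _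
  obtain ⟨S, hS, hSi⟩ := exists_hull_eq_chamber hg D
  refine ⟨S.image (cls Δ), ?_, ?_⟩
  · rw [Finset.coe_image]
    rintro _ ⟨E, hE, rfl⟩
    choose k hk using (hSi E hE).1
    exact ⟨k, congrArg _ (funext hk)⟩
  · rw [Finset.coe_image, gammaCone, ← hS, map_hull]
    rfl

theorem eq_zero_of_neg_mem_gammaCone {D : WeilDivisor Δ} (hD : (poly Ray.gen D).Nonempty)
    {x : ClassGroup Δ} (hx : x ∈ gammaCone D) (hx' : -x ∈ gammaCone D) : x = 0 := by
  obtain ⟨E, rfl⟩ := cls_surjective x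
  obtain ⟨u, hu⟩ := eq_linear_of_neg_mem_chamber hD (cls_mem_gammaCone.1 hx)
    (cls_mem_gammaCone.1 (show cls Δ (-E) ∈ gammaCone D from hx'))
  exact cls_eq_cls_iff.2 ⟨u, by ext ρ; simp [hu]⟩

variable
  (hsupp : (PointedCone.hull ℝ (Set.range (Ray.gen (Δ := Δ))) : Set (Fin n → ℝ)) = support Δ)

include hsupp

/-- Effectivity in `gkzCone` is no extra condition: members of the chamber have nonempty polyhedra,
and translating a point of the polyhedron to 0 gives an effective representative. -/
theorem gkzCone_normalFan {D : WeilDivisor Δ} (hD : (poly Ray.gen D).Nonempty) :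
    gkzCone Δ (normalFan D) (excessRays D) = gammaCone D := by
  ext c
  constructor
  · rintro ⟨E, hE, rfl, h⟩
    exact cls_mem_gammaCone.2
      ((refines_normalFan_iff hsupp hD (poly_nonempty_of_nonneg hE)).1 h)
  · intro hc
    obtain ⟨F, rfl⟩ := cls_surjective c
    have hF := cls_mem_gammaCone.1 hc
    obtain ⟨E, hE, hEF⟩ := exists_nonneg_cls_eq (poly_nonempty_of_mem_chamber hD hF)
    refine ⟨E, hE, hEF, (refines_normalFan_iff hsupp hD (poly_nonempty_of_nonneg hE)).2 ?_⟩
    obtain ⟨u, rfl⟩ := cls_eq_cls_iff.1 hEF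
    exact (add_linear_mem_chamber u).2 hF

theorem mem_gkzFan_iff {C : PointedCone ℝ (ClassGroup Δ)} :
    C ∈ gkzFan Δ ↔ ∃ D : WeilDivisor Δ, (poly Ray.gen D).Nonempty ∧ C = gammaCone D := by
  constructor
  · rintro ⟨S, I, h, hC⟩
    obtain ⟨D, hD, rfl, rfl⟩ := h.exists_divisor hsupp
    have hD' := poly_nonempty_of_nonneg hD
    exact ⟨D, hD', SetLike.coe_injective (hC.trans (gkzCone_normalFan hsupp hD'))⟩
  · rintro ⟨D, hD, rfl⟩
    exact ⟨_, _, isGKZPair_normalFan hsupp hD, (gkzCone_normalFan hsupp hD).symm⟩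

theorem isFan_gkzFan : IsFan (integralClasses Δ) (gkzFan Δ) where
  finite := by
    -- The face sets common to all members of the cone of D are those of D itself, and they
    -- determine the chamber; there are finitely many collections of sets of rays.
    refine Set.Finite.of_injOn (f := fun C : PointedCone ℝ (ClassGroup Δ) =>
      {K : Set (Ray Δ) | ∀ E, cls Δ E ∈ C → IsFaceSet Ray.gen E K})
      (Set.mapsTo_univ _ _) ?_ Set.finite_univ
    have key : ∀ D : WeilDivisor Δ, {K : Set (Ray Δ) | ∀ E, cls Δ E ∈ gammaCone D →
        IsFaceSet Ray.gen E K} = {K | IsFaceSet Ray.gen D K} := by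
      intro D
      ext K
      exact ⟨fun h => h D (cls_mem_gammaCone.2 (self_mem_chamber D)),
        fun h E hE => cls_mem_gammaCone.1 hE K h⟩
    intro C hC C' hC' h
    obtain ⟨D, -, rfl⟩ := (mem_gkzFan_iff hsupp).1 hC
    obtain ⟨E, -, rfl⟩ := (mem_gkzFan_iff hsupp).1 hC'
    have hDE : {K | IsFaceSet Ray.gen D K} = {K | IsFaceSet Ray.gen E K} := by
      rw [← key, ← key]
      exact h
    have : chamber Ray.gen D = chamber Ray.gen E := by
      ext F
      exact forall_congr' fun K => imp_congr_left (Set.ext_iff.1 hDE K)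
    rw [gammaCone, gammaCone, this]
  nonempty := ⟨_, (mem_gkzFan_iff hsupp).2 ⟨0, poly_nonempty_of_nonneg le_rfl, rfl⟩⟩
  rational C hC := by
    obtain ⟨D, -, rfl⟩ := (mem_gkzFan_iff hsupp).1 hC
    exact isRationalPolyhedral_gammaCone D
  face_mem C hC G hG := by
    obtain ⟨D, hD, rfl⟩ := (mem_gkzFan_iff hsupp).1 hC
    obtain ⟨E, hE, rfl⟩ := exists_eq_gammaCone_of_isFaceOf hD hG
    exact (mem_gkzFan_iff hsupp).2 ⟨E, poly_nonempty_of_mem_chamber hD hE, rfl⟩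
  inter_left C hC C' hC' := by
    obtain ⟨D, hD, rfl⟩ := (mem_gkzFan_iff hsupp).1 hC
    obtain ⟨E, -, rfl⟩ := (mem_gkzFan_iff hsupp).1 hC'
    rw [gammaCone_isFaceOf_iff, ← comap_gammaCone D]
    have := chamber_inf_isFaceOf (E := E) hD
    rw [← comap_gammaCone D, ← comap_gammaCone E] at this
    exact this
  inter_right C hC C' hC' := by
    obtain ⟨D, -, rfl⟩ := (mem_gkzFan_iff hsupp).1 hC
    obtain ⟨E, hE, rfl⟩ := (mem_gkzFan_iff hsupp).1 hC'
    rw [inf_comm, gammaCone_isFaceOf_iff, ← comap_gammaCone E]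
    have := chamber_inf_isFaceOf (E := D) hE
    rw [← comap_gammaCone D, ← comap_gammaCone E] at this
    exact this
  stronglyConvex C hC x hx hx' := by
    obtain ⟨D, hD, rfl⟩ := (mem_gkzFan_iff hsupp).1 hC
    exact eq_zero_of_neg_mem_gammaCone hD hx hx'

theorem support_gkzFan : support (gkzFan Δ) = effectiveCone Δ := by
  ext c
  constructor
  · intro hc
    obtain ⟨C, ⟨S, I, -, hC⟩, hc⟩ := Set.mem_iUnion₂.1 hc
    rw [hC] at hc
    obtain ⟨D, hD, hDc, -⟩ := hc
    exact ⟨D, hD, hDc⟩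
  · rintro ⟨D, hD, rfl⟩
    exact Set.mem_biUnion ((mem_gkzFan_iff hsupp).2 ⟨D, poly_nonempty_of_nonneg hD, rfl⟩)
      (cls_mem_gammaCone.2 (self_mem_chamber D))

theorem isFaceOf_gammaCone_iff {D E : WeilDivisor Δ} (hD : (poly Ray.gen D).Nonempty)
    (hE : (poly Ray.gen E).Nonempty) :
    (gammaCone E).IsFaceOf (gammaCone D) ↔
      Refines (normalFan D) (normalFan E) ∧ excessRays E ⊆ excessRays D := by
  rw [isFaceOf_gammaCone_iff_mem hD, refines_normalFan_iff hsupp hD hE]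

end GKZFan

end GKZ

theorem mainTheorem10 (n : ℕ) (Δ : Set (PointedCone ℝ (Fin n → ℝ)))
    (hΔ : GKZ.IsFan (GKZ.latticeN n) Δ)
    (hconv : Convex ℝ (GKZ.support Δ))
    (hdim : GKZ.coneDim (GKZ.support Δ) = n) :
    -- every GKZ cone is a rational polyhedral cone of the asserted dimension
    (∀ (S : Set (PointedCone ℝ (Fin n → ℝ))) (I : Set (GKZ.Ray Δ)), GKZ.IsGKZPair Δ S I →
      ∃ C : PointedCone ℝ (GKZ.ClassGroup Δ),
        (C : Set (GKZ.ClassGroup Δ)) = GKZ.gkzCone Δ S I ∧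
        GKZ.IsRationalPolyhedral (GKZ.integralClasses Δ) C ∧
        GKZ.coneDim (C : Set (GKZ.ClassGroup Δ)) =
          Module.finrank ℚ (GKZ.PicQ S) + I.ncard) ∧
    -- the GKZ cones form a fan supported on the effective cone
    GKZ.IsFan (GKZ.integralClasses Δ) (GKZ.gkzFan Δ) ∧
    GKZ.support (GKZ.gkzFan Δ) = GKZ.effectiveCone Δ ∧
    -- the faces of a GKZ cone
    (∀ (S : Set (PointedCone ℝ (Fin n → ℝ))) (I : Set (GKZ.Ray Δ)), GKZ.IsGKZPair Δ S I →
      ∀ C : PointedCone ℝ (GKZ.ClassGroup Δ),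
        (C : Set (GKZ.ClassGroup Δ)) = GKZ.gkzCone Δ S I →
        (∀ F : PointedCone ℝ (GKZ.ClassGroup Δ), F.IsFaceOf C ↔
          ∃ (S' : Set (PointedCone ℝ (Fin n → ℝ))) (I' : Set (GKZ.Ray Δ)),
            GKZ.IsGKZPair Δ S' I' ∧ GKZ.Refines S S' ∧ I' ⊆ I ∧
            (F : Set (GKZ.ClassGroup Δ)) = GKZ.gkzCone Δ S' I') ∧
        (∀ (S' : Set (PointedCone ℝ (Fin n → ℝ))) (I' : Set (GKZ.Ray Δ)),
          GKZ.IsGKZPair Δ S' I' →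
          ∀ F : PointedCone ℝ (GKZ.ClassGroup Δ),
            (F : Set (GKZ.ClassGroup Δ)) = GKZ.gkzCone Δ S' I' →
            (F.IsFaceOf C ↔ GKZ.Refines S S' ∧ I' ⊆ I))) := by
  have hfin : Finite (GKZ.Ray Δ) := GKZ.finite_ray hΔ.finite
  have hft : Fintype (GKZ.Ray Δ) := Fintype.ofFinite _
  have hsupp := GKZ.coe_hull_range_gen hΔ hconv
  have hinj : ∀ u : Fin n → ℝ, (∀ ρ : GKZ.Ray Δ, u ⬝ᵥ ρ.gen = 0) → u = 0 := fun u hu =>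
    GKZ.eq_zero_of_forall_gen hsupp hdim hu
  refine ⟨fun S I h => ?_, GKZ.isFan_gkzFan hsupp, GKZ.support_gkzFan hsupp,
    fun S I h C hC => ?_⟩
  · obtain ⟨D, hD, rfl, rfl⟩ := h.exists_divisor hsupp
    have hD' := GKZ.poly_nonempty_of_nonneg hD
    exact ⟨GKZ.gammaCone D, (GKZ.gkzCone_normalFan hsupp hD').symm,
      GKZ.isRationalPolyhedral_gammaCone D, GKZ.finrank_span_image_chamber hsupp hinj hD'⟩
  obtain ⟨D, hD, rfl, rfl⟩ := h.exists_divisor hsupp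
  have hD' := GKZ.poly_nonempty_of_nonneg hD
  obtain rfl : C = GKZ.gammaCone D :=
    SetLike.coe_injective (hC.trans (GKZ.gkzCone_normalFan hsupp hD'))
  have key : ∀ (S' : Set (PointedCone ℝ (Fin n → ℝ))) (I' : Set (GKZ.Ray Δ)),
      GKZ.IsGKZPair Δ S' I' → ∀ F : PointedCone ℝ (GKZ.ClassGroup Δ),
      (F : Set (GKZ.ClassGroup Δ)) = GKZ.gkzCone Δ S' I' →
      (F.IsFaceOf (GKZ.gammaCone D) ↔
        GKZ.Refines (GKZ.normalFan D) S' ∧ I' ⊆ GKZ.excessRays D) := by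
    intro S' I' h' F hF
    obtain ⟨E, hE, rfl, rfl⟩ := h'.exists_divisor hsupp
    have hE' := GKZ.poly_nonempty_of_nonneg hE
    obtain rfl : F = GKZ.gammaCone E :=
      SetLike.coe_injective (hF.trans (GKZ.gkzCone_normalFan hsupp hE'))
    exact GKZ.isFaceOf_gammaCone_iff hsupp hD' hE'
  refine ⟨fun F => ⟨fun hF => ?_, ?_⟩, key⟩
  · obtain ⟨E, hE, rfl⟩ := GKZ.exists_eq_gammaCone_of_isFaceOf hD' hF
    have hE' := GKZ.poly_nonempty_of_mem_chamber hD' hE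
    obtain ⟨h1, h2⟩ := (GKZ.isFaceOf_gammaCone_iff hsupp hD' hE').1 hF
    exact ⟨_, _, GKZ.isGKZPair_normalFan hsupp hE', h1, h2,
      (GKZ.gkzCone_normalFan hsupp hE').symm⟩
  · rintro ⟨S', I', h', h1, h2, hF⟩
    exact (key S' I' h' F hF).2 ⟨h1, h2⟩
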